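/- Let $G=(V,E)$ be a finite simple graph with a hierarchy of quotient multigraphs $H_0(G)=G, H_1(G),\dots,H_\ell(G)$, $\ell\ge 0$: for $1\le n\le\ell$ a partition of $V(H_{n-1}(G))$ into nonempty blocks is given, $V(H_n(G))$ is the set of its blocks, and $H_n(G)$ has exactly one edge for every edge of $H_{n-1}(G)$ that joins two different blocks (parallel edges are kept, edges inside a block are dropped). So every edge of $H_n(G)$ corresponds to a unique edge of $G$. Let $\mathcal Q$ be the coarsening operator, which sends a spanning subgraph of $H_{n-1}(G)$ to the corresponding spanning subgraph of $H_n(G)$, and for $v\in V(H_n(G))$, $1\le n\le \ell$, let $\mathcal Q^{-1}(v)$ be the sub-multigraph of $H_{n-1}(G)$ induced by the vertices in the block $v$. Let $HT(G)$ be the set of hierarchical trees, that is, of the spanning trees $t$ of $G$ such that $\mathcal Q^n(t)$ is a spanning tree of $H_n(G)$ for all $0\le n\le \ell$, and let $\tau_{\mathcal H}(G)=|HT(G)|$. Assume that $H_\ell(G)$ and all block multigraphs $\mathcal Q^{-1}(v)$ are connected (and nonempty). Draw independent spanning trees with Wilson's algorithm on $H_\ell(G)$ and on $\mathcal Q^{-1}(v)$,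 for every $1\le n\le\ell$ and every $v\in V(H_n(G))$. Here Wilson's algorithm on a connected multigraph starts from the tree that consists of an arbitrary root; as long as the tree does not span, it chooses by an arbitrary rule (depending on the present tree) a vertex outside the tree, runs from it the random walk that at each step takes a uniformly random edge at the current vertex until the walk hits the tree, and adds the loop erasure of this walk to the tree. Then each run of Wilson's algorithm halts with probability $1$, $HT(G)\neq\emptyset$, and the set of the edges of $G$ that correspond to the edges of all the drawn trees is the edge set of a uniformly random element of $HT(G)$: each $t\in HT(G)$ is obtained with probability $1/\tau_{\mathcal H}(G)$. -/

import Mathlib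

open scoped ENNReal

/-! ### Multigraphs, trees and spanning trees

`Graph α β` is Mathlib's type of multigraphs, with vertices in `α` and edges in `β`. -/

namespace Graph

universe u v w

variable {α : Type u} {α' : Type v} {β : Type w}

/-- A multigraph is connected if it has a vertex and any two vertices are joined by a walk. -/
def IsConn (H : Graph α β) : Prop :=
  H.vertexSet.Nonempty ∧
    ∀ x ∈ H.vertexSet, ∀ y ∈ H.vertexSet, Relation.ReflTransGen H.Adj x y

/-- A multigraph is acyclic if there is no cycle `v 0, e 0, v 1, e 1, …, v k, e k, v 0` with
distinct vertices and distinct edges. The addition in `Fin (k + 1)` is cyclic; `k = 0` excludes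
loops, and `k = 1` excludes pairs of parallel edges. -/
def IsForest (H : Graph α β) : Prop :=
  ∀ (k : ℕ) (v : Fin (k + 1) → α) (e : Fin (k + 1) → β),
    Function.Injective v → Function.Injective e → ¬ ∀ i, H.IsLink (e i) (v i) (v (i + 1))

/-- A tree is a connected acyclic multigraph. -/
def IsTree (H : Graph α β) : Prop := H.IsConn ∧ H.IsForest

/-- `t` is a spanning tree of `H`: a subgraph with the same vertex set that is a tree. -/
def IsSpanningTreeOf (t H : Graph α β) : Prop := t.IsSpanningSubgraph H ∧ t.IsTree

/-- The quotient multigraph of `H` under a map `q` of its vertices to coarse vertices: one edge for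
each edge of `H` that joins vertices with different images. Parallel edges are kept, edges
inside one block are dropped, and an edge of the quotient carries the same name as the edge of `H`
that it comes from. -/
def coarsen (q : α → α') (H : Graph α β) : Graph α' β :=
  (H.map q).deleteEdges {e | ∃ x, (H.map q).IsLoopAt e x}

/-! ### Wilson's algorithm -/

/-- The state of Wilson's algorithm: the tree built so far (`verts`, `edges`), and the loop erasure
of the current random walk, which is at `cur`; `path` lists, latest first, the vertices through
which the loop-erased walk has come, each with the edge by which the walk left it. -/
structure WilsonState (α : Type u) (β : Type w) where
  verts : Set α
  edges : Set β
  path : List (α × β)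
  cur : α

/-- The free choices in Wilson's algorithm on `H`: the root, and the rule that tells from which
vertex outside the present tree (with vertices `A` and edges `F`) the next walk starts. -/
structure WilsonRule (H : Graph α β) where
  root : α
  root_mem : root ∈ H.vertexSet
  next : Set α → Set β → α
  next_mem : ∀ (A : Set α) (F : Set β), A ⊂ H.vertexSet → next A F ∈ H.vertexSet \ A

open Classical in
/-- The possible steps of the random walk at `x`: an edge at `x` and its other end. -/
noncomputable def walkSteps [Fintype α] [Fintype β] (H : Graph α β) (x : α) : Finset (β × α) :=
  Finset.univ.filter fun p => H.IsLink p.1 x p.2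

open Classical in
/-- The walk goes along `p.1` from the current vertex to `p.2`, and if this closes a loop of the
loop-erased path, that loop is erased. -/
noncomputable def WilsonState.move (s : WilsonState α β) (p : β × α) : WilsonState α β :=
  let l := (s.cur, p.1) :: s.path
  { s with
    path := if p.2 ∈ l.map Prod.fst then (l.dropWhile fun a => decide (a.1 ≠ p.2)).tail else l
    cur := p.2 }

open Classical in
/-- One step of Wilson's algorithm. If the walk has reached the tree, its loop-erased path is added
to the tree, and unless the tree now spans `H` (the algorithm has halted) a new walk is started.
Otherwise the walk makes a step, uniform over the edges at the current vertex. (The last branch is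
the case of an isolated vertex, where no step is possible.) -/
noncomputable def wilsonStep [Fintype α] [Fintype β] (H : Graph α β) (R : WilsonRule H)
    (s : WilsonState α β) : PMF (WilsonState α β) :=
  if s.cur ∈ s.verts then
    let A := s.verts ∪ {x | x ∈ s.path.map Prod.fst}
    let F := s.edges ∪ {e | e ∈ s.path.map Prod.snd}
    PMF.pure ⟨A, F, [], if A = H.vertexSet then s.cur else R.next A F⟩
  else if h : (H.walkSteps s.cur).Nonempty then
    (PMF.uniformOfFinset (H.walkSteps s.cur) h).map s.move
  else PMF.pure s

/-- The distribution of the state of Wilson's algorithm after `k` steps; it starts with the tree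
that consists of the root alone. -/
noncomputable def wilsonRun [Fintype α] [Fintype β] (H : Graph α β) (R : WilsonRule H) :
    ℕ → PMF (WilsonState α β)
  | 0 => PMF.pure ⟨{R.root}, ∅, [], R.root⟩
  | k + 1 => (wilsonRun H R k).bind (wilsonStep H R)

/-- The law of the output (an edge set) of Wilson's algorithm. The mass of `T` is the probability
that the algorithm halts with output `T`, which is the supremum over `k` of the probability that
it has done so within `k` steps, since halted states are never left. The total mass is the
probability that the algorithm halts. -/
noncomputable def wilsonLaw [Fintype α] [Fintype β] (H : Graph α β) (R : WilsonRule H) :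
    MeasureTheory.Measure (Set β) :=
  MeasureTheory.Measure.sum fun T : Set β =>
    (⨆ k, (wilsonRun H R k).toOuterMeasure {s | s.verts = H.vertexSet ∧ s.edges = T}) •
      MeasureTheory.Measure.dirac T

end Graph

/-! ### Hierarchies and hierarchical trees -/

universe u in
/-- A nested sequence of partitions. `Node n` is the set of vertices at level `n`, and `Node 0` is
the set of vertices of the base graph. A partition of `Node n` is given by the map `up n` that
sends each vertex to its block; the blocks, all of them nonempty, are the vertices at level
`n + 1`. A hierarchy with top level `ℓ` uses the levels up to `ℓ` only. -/
structure Hierarchy where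
  Node : ℕ → Type u
  up : ∀ n, Node n → Node (n + 1)
  up_surjective : ∀ n, Function.Surjective (up n)

namespace Hierarchy

universe u w

variable (h : Hierarchy.{u}) {β : Type w}

/-- The coarsening operator iterated `n` times, from graphs on the base vertices to graphs at level
`n`. Applied to the base graph it gives the hierarchy of quotient multigraphs. -/
def quot (H : Graph (h.Node 0) β) : ∀ n, Graph (h.Node n) β
  | 0 => H
  | n + 1 => (quot H n).coarsen (h.up n)

/-- The block multigraph of the vertex `v` at level `n + 1`: the subgraph of the quotient
multigraph at level `n` that is induced by the vertices in the block `v`. -/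
def block (H : Graph (h.Node 0) β) (n : ℕ) (v : h.Node (n + 1)) : Graph (h.Node n) β :=
  (h.quot H n).induce (h.up n ⁻¹' {v})

/-- The hierarchical trees of `H` for the hierarchy with top level `ℓ`, given by their edge sets:
the spanning trees all of whose coarsenings are spanning trees of the quotient multigraphs. -/
def hierTrees (ℓ : ℕ) (H : Graph (h.Node 0) β) : Set (Set β) :=
  {T | T ⊆ H.edgeSet ∧ ∀ n ≤ ℓ, (h.quot (H.restrict T) n).IsSpanningTreeOf (h.quot H n)}

/-- The law of the union of independent outputs of Wilson's algorithm on the coarsest quotient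
multigraph (with choices `R`) and on all block multigraphs (with choices `S`). -/
noncomputable def drawLaw [∀ n, Fintype (h.Node n)] [Fintype β] (ℓ : ℕ) (H : Graph (h.Node 0) β)
    (R : (h.quot H ℓ).WilsonRule)
    (S : ∀ b : (n : Fin ℓ) × h.Node (n + 1), (h.block H b.1 b.2).WilsonRule) :
    MeasureTheory.Measure (Set β) :=
  ((Graph.wilsonLaw _ R).prod (MeasureTheory.Measure.pi fun b => Graph.wilsonLaw _ (S b))).map
    fun p => p.1 ∪ ⋃ b, p.2 b

end Hierarchy

/-! Every edge of `G` either survives to level `ℓ` or becomes internal to a block at exactly one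
level, so the edges of `G` are divided among the coarsest quotient and the blocks. Counting edges
shows that a set which coarsens to a spanning tree is a spanning tree exactly when it is one inside
every block (`inter_mem_treeSets_iff_forall`). Applied from the top level downwards, this makes the
hierarchical trees exactly the unions of one spanning tree per piece (`bijOn_assemble`), and a
product of uniform laws carried through a bijection is uniform (`drawLaw_singleton`).

What remains is Wilson's theorem, `iSup_wilsonRun_halted`. For a fixed spanning tree `T`, an
explicit function of the state, `Orientation.value`, is shown to be the conditional probability that
the output is `T`. Its main term is the inverse determinant of the Laplacian with the tree and the
current path as Dirichlet boundary, as long as both agree with `T`; correction terms account for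
returns of the walk to its path. That the function is harmonic (`sum_value_move`) comes down to
Cramer's rule: one more boundary vertex divides the determinant by its degree times its escape
probability (`lap_hitProb_self_mul_det`). The function `timeBound` decreases by at least one on
average in each step before halting, so the algorithm halts almost surely and a harmonic function
with the right values at halted states is the probability sought (`PMF.iSup_toOuterMeasure_eq`). The
value at the start does not depend on `T`; this is uniformity. -/

namespace Graph

universe u v w

variable {α : Type u} {α' : Type v} {β : Type w} {H K : Graph α β} {r : α} {A : Set α} {F T : Set β}

/-! ### Trees grown leaf by leaf -/

/-- `(A, F)` is a tree in `H` that is grown from `r` by attaching one leaf after the other. -/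
inductive IsArb (H : Graph α β) (r : α) : Set α → Set β → Prop
  | root : IsArb H r {r} ∅
  | attach {A : Set α} {F : Set β} {e : β} {x y : α} : IsArb H r A F → x ∉ A → y ∈ A →
      H.IsLink e x y → IsArb H r (insert x A) (insert e F)

namespace IsArb

lemma root_mem (h : H.IsArb r A F) : r ∈ A := by
  induction h with
  | root => rfl
  | attach _ _ _ _ ih => exact Or.inr ih

lemma subset_vertexSet (h : H.IsArb r A F) (hr : r ∈ H.vertexSet) : A ⊆ H.vertexSet := by
  induction h with
  | root => simpa using hr
  | attach _ _ _ hl ih => exact Set.insert_subset hl.left_mem ih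

lemma subset_edgeSet (h : H.IsArb r A F) : F ⊆ H.edgeSet := by
  induction h with
  | root => simp
  | attach _ _ _ hl ih => exact Set.insert_subset hl.edge_mem ih

lemma end_mem (h : H.IsArb r A F) {e : β} (he : e ∈ F) {x y : α} (hl : H.IsLink e x y) : x ∈ A := by
  induction h with
  | root => simp at he
  | attach _ _ hy hl' ih =>
    rcases he with rfl | he
    · rcases hl.left_eq_or_eq hl' with rfl | rfl
      · exact Or.inl rfl
      · exact Or.inr hy
    · exact Or.inr (ih he)

lemma edge_notMem (h : H.IsArb r A F) {e : β} {x y : α} (hx : x ∉ A) (hl : H.IsLink e x y) :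
    e ∉ F := fun he => hx (h.end_mem he hl)

lemma ncard [Finite α] [Finite β] (h : H.IsArb r A F) : F.ncard + 1 = A.ncard := by
  induction h with
  | root => simp
  | attach h hx hy hl ih =>
    rw [Set.ncard_insert_of_notMem hx (Set.toFinite _),
      Set.ncard_insert_of_notMem (h.edge_notMem hx hl) (Set.toFinite _), ih]

lemma congr (h : H.IsArb r A F) (hHK : ∀ e ∈ F, ∀ x y, H.IsLink e x y → K.IsLink e x y) :
    K.IsArb r A F := by
  induction h with
  | root => exact .root
  | attach _ hx hy hl ih =>
    exact .attach (ih fun e he => hHK e (Or.inr he)) hx hy (hHK _ (Or.inl rfl) _ _ hl)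

lemma reach (h : H.IsArb r A F) {x : α} (hx : x ∈ A) :
    Relation.ReflTransGen (H.restrict F).Adj r x := by
  induction h generalizing x with
  | root => rw [Set.mem_singleton_iff.1 hx]
  | @attach A F e x₀ y _ hx₀ hy hl ih =>
    have mono : ∀ {z}, z ∈ A → Relation.ReflTransGen (H.restrict (insert e F)).Adj r z := by
      intro z hz
      refine (ih hz).lift id ?_
      rintro a b ⟨f, hf⟩
      exact ⟨f, by simp at hf ⊢; tauto⟩
    rcases hx with rfl | hx
    · exact (mono hy).tail ⟨e, by simp [hl.symm]⟩
    · exact mono hx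

/-- A path to the newest leaf extends a path to its neighbour. Only the vertices are required to be
distinct: this already forces the edges to be distinct, as the cycle in `edge_mem_of_isForest`
requires. -/
lemma exists_path (h : H.IsArb r A F) {x y : α} (hx : x ∈ A) (hy : y ∈ A) :
    ∃ (k : ℕ) (v : ℕ → α), v 0 = x ∧ v k = y ∧
      (∀ i < k, ∃ e ∈ F, H.IsLink e (v i) (v (i + 1))) ∧ Set.InjOn v (Set.Iic k) ∧
      ∀ i ≤ k, v i ∈ A := by
  induction h generalizing x y with
  | root =>
    obtain rfl : x = r := hx
    obtain rfl : y = x := hy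
    exact ⟨0, fun _ => y, rfl, rfl, by simp, by simp [Set.InjOn], by simp⟩
  | @attach A F e x₀ y₀ h hx₀ hy₀ hl ih =>
    have key : ∀ z ∈ A, ∃ (k : ℕ) (v : ℕ → α), v 0 = z ∧ v k = x₀ ∧
        (∀ i < k, ∃ e' ∈ insert e F, H.IsLink e' (v i) (v (i + 1))) ∧ Set.InjOn v (Set.Iic k) ∧
        ∀ i ≤ k, v i ∈ insert x₀ A := by
      intro z hz
      obtain ⟨k, v, h0, hk, hlk, hinj, hmem⟩ := ih hz hy₀
      refine ⟨k + 1, fun i => if i ≤ k then v i else x₀, by simp [h0], by simp, ?_, ?_, ?_⟩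
      · intro i hi
        rcases Nat.lt_succ_iff_lt_or_eq.1 hi with hi | rfl
        · obtain ⟨e', he', hl'⟩ := hlk i hi
          exact ⟨e', Or.inr he', by simpa [hi.le, Nat.succ_le_of_lt hi] using hl'⟩
        · exact ⟨e, Or.inl rfl, by simpa [hk] using hl.symm⟩
      · intro i hi j hj hij
        simp only [Set.mem_Iic] at hi hj
        by_cases h1 : i ≤ k <;> by_cases h2 : j ≤ k <;> simp only [h1, h2, if_true, if_false] at hij
        · exact hinj h1 h2 hij
        · exact absurd (hij ▸ hmem i h1) hx₀
        · exact absurd (hij ▸ hmem j h2) hx₀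
        · omega
      · intro i _
        by_cases h1 : i ≤ k
        · simpa [h1] using Or.inr (hmem i h1)
        · simp [h1]
    rcases hx with rfl | hx <;> rcases hy with rfl | hy
    · exact ⟨0, fun _ => y, rfl, rfl, by simp, by simp [Set.InjOn], by simp⟩
    · obtain ⟨k, v, h0, hk, hlk, hinj, hmem⟩ := key y hy
      refine ⟨k, fun i => v (k - i), by simpa using hk, by simpa using h0, ?_, ?_, ?_⟩
      · intro i hi
        obtain ⟨e', he', hl'⟩ := hlk (k - (i + 1)) (by omega)
        refine ⟨e', he', ?_⟩
        rw [show k - (i + 1) + 1 = k - i by omega] at hl'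
        exact hl'.symm
      · intro i hi j hj hij
        have := hinj (Nat.sub_le k i) (Nat.sub_le k j) hij
        simp only [Set.mem_Iic] at hi hj
        omega
      · exact fun i _ => hmem _ (Nat.sub_le k i)
    · exact key x hx
    · obtain ⟨k, v, h0, hk, hlk, hinj, hmem⟩ := ih hx hy
      exact ⟨k, v, h0, hk, fun i hi => let ⟨e', he', hl'⟩ := hlk i hi; ⟨e', Or.inr he', hl'⟩, hinj,
        fun i hi => Or.inr (hmem i hi)⟩

/-- An edge outside a tree that joins two vertices of the tree closes a cycle. -/
lemma edge_mem_of_isForest (h : H.IsArb r A F) (hFT : F ⊆ T) (hT : (H.restrict T).IsForest)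
    {e : β} (he : e ∈ T) {x y : α} (hx : x ∈ A) (hy : y ∈ A) (hl : H.IsLink e x y) : e ∈ F := by
  by_contra heF
  obtain ⟨k, v, h0, hk, hlk, hinj, -⟩ := h.exists_path hx hy
  choose c hcF hcl using hlk
  refine hT k (fun i => v i) (fun i => if hi : (i : ℕ) < k then c i hi else e) ?_ ?_ ?_
  · intro i j hij
    exact Fin.ext (hinj (Nat.lt_succ_iff.1 i.2) (Nat.lt_succ_iff.1 j.2) hij)
  · intro i j hij
    dsimp only at hij
    by_cases hi : (i : ℕ) < k <;> by_cases hj : (j : ℕ) < k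
    · rw [dif_pos hi, dif_pos hj] at hij
      have h1 := hcl i hi
      rw [hij] at h1
      rcases h1.eq_and_eq_or_eq_and_eq (hcl j hj) with h2 | h2
      · exact Fin.ext (hinj hi.le hj.le h2.1)
      -- One edge used in both directions would give `i = j + 1` and `i + 1 = j`.
      · have h3 := hinj (x₁ := (i : ℕ)) (x₂ := j + 1) hi.le (Nat.succ_le_of_lt hj) h2.1
        have h4 := hinj (x₁ := (i : ℕ) + 1) (x₂ := j) (Nat.succ_le_of_lt hi) hj.le h2.2
        omega
    · rw [dif_pos hi, dif_neg hj] at hij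
      exact absurd (hij ▸ hcF _ hi) heF
    · rw [dif_neg hi, dif_pos hj] at hij
      exact absurd (hij.symm ▸ hcF _ hj) heF
    · exact Fin.ext (by omega)
  · intro i
    by_cases hi : (i : ℕ) < k
    · have h1 : ((i + 1 : Fin (k + 1)) : ℕ) = i + 1 := by
        rw [Fin.val_add_one, if_neg]
        intro h2
        rw [h2] at hi
        simp at hi
      rw [dif_pos hi, h1, restrict_isLink]
      exact ⟨hFT (hcF _ hi), hcl _ hi⟩
    -- At the last index `i + 1` wraps around to `0`, and `e` closes the cycle.
    · obtain rfl : i = Fin.last k := Fin.ext (by simp; omega)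
      simp only [Fin.val_last, lt_irrefl, dite_false, Fin.last_add_one, Fin.val_zero, hk, h0,
        restrict_isLink]
      exact ⟨he, hl.symm⟩

/-- A cycle through the newest leaf must enter and leave it by the only edge there, so it has length
one; but that edge is not a loop. A cycle that avoids the leaf lies in the smaller tree. -/
lemma isForest (h : H.IsArb r A F) : (H.restrict F).IsForest := by
  induction h with
  | root =>
    intro k v e _ _ hc
    simpa using hc 0
  | @attach A F e₀ x y h hx hy hl ih =>
    intro k v e hv he hc
    simp only [restrict_isLink] at hc
    by_cases hxv : ∃ i, v i = x
    · obtain ⟨i, rfl⟩ := hxv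
      have key : ∀ j z, H.IsLink (e j) (v i) z → e j = e₀ := by
        intro j z hz
        exact (hc j).1.resolve_right (h.edge_notMem hx hz)
      have h1 := hc i
      have h2 := hc (i - 1)
      rw [sub_add_cancel] at h2
      have h3 : e i = e (i - 1) := (key _ _ h1.2).trans (key _ _ h2.2.symm).symm
      have h4 := he h3
      rw [← h4] at h2
      have h5 := h2.2
      rw [key _ _ h1.2] at h5
      rcases h5.left_eq_or_eq hl with h6 | h6 <;> rcases h5.right_eq_or_eq hl with h7 | h7
      · have h8 := h5.isLink_iff_eq.1 hl
        exact hx (h8 ▸ hy)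
      all_goals first | exact hx (h6 ▸ hy) | exact hx (h7 ▸ hy)
    · refine ih k v e hv he fun i => ?_
      rw [restrict_isLink]
      refine ⟨(hc i).1.resolve_left fun hi => ?_, (hc i).2⟩
      have h1 := (hc i).2
      rw [hi] at h1
      rcases hl.left_eq_or_eq h1 with h2 | h2
      · exact hxv ⟨_, h2.symm⟩
      · exact hxv ⟨_, h2.symm⟩

end IsArb

/-! ### Spanning trees as edge sets -/

lemma reach_symm {x y : α} (h : Relation.ReflTransGen H.Adj x y) :
    Relation.ReflTransGen H.Adj y x := by
  induction h with
  | refl => exact .refl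
  | tail _ hyz ih => exact .head hyz.symm ih

lemma isConn_of_reach (hr : r ∈ H.vertexSet)
    (h : ∀ x ∈ H.vertexSet, Relation.ReflTransGen H.Adj r x) : H.IsConn :=
  ⟨⟨r, hr⟩, fun x hx y hy =>
    (reach_symm (h x hx)).trans (h y hy)⟩

lemma IsArb.isTree (h : H.IsArb r A F) (hA : A = H.vertexSet) : (H.restrict F).IsTree :=
  ⟨isConn_of_reach (hA ▸ h.root_mem) fun _ hx => h.reach (hA ▸ hx), h.isForest⟩

/-- A connected finite multigraph has a spanning tree grown from any vertex. -/
lemma IsConn.exists_isArb [Finite α] (h : H.IsConn) (hr : r ∈ H.vertexSet) :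
    ∃ F, H.IsArb r H.vertexSet F := by
  obtain ⟨A, ⟨F, hA⟩, hmax⟩ := Set.Finite.exists_maximal (s := {A | ∃ F, H.IsArb r A F})
    (Set.toFinite _) ⟨_, _, .root⟩
  suffices A = H.vertexSet from ⟨F, this ▸ hA⟩
  refine (hA.subset_vertexSet hr).antisymm fun x hx => ?_
  have := h.2 r hr x hx
  clear hx
  induction this with
  | refl => exact hA.root_mem
  | @tail y z _ hyz ih =>
    obtain ⟨e, he⟩ := hyz
    by_contra hz
    exact hz (hmax ⟨_, hA.attach hz ih he.symm⟩ (Set.subset_insert _ _) (Or.inl rfl))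

lemma IsArb.of_restrict (h : (H.restrict T).IsArb r A F) : H.IsArb r A F :=
  h.congr fun _ _ _ _ hl => hl.mono restrict_le

/-- A tree grown inside `T` until it spans already contains all of `T`, since a further edge would
close a cycle. The root is arbitrary, so the same `T` can be grown from whichever root Wilson's
algorithm uses. -/
lemma IsTree.isArb [Finite α] (h : (H.restrict T).IsTree) (hT : T ⊆ H.edgeSet)
    (hr : r ∈ H.vertexSet) : H.IsArb r H.vertexSet T := by
  obtain ⟨F, hF⟩ := h.1.exists_isArb (r := r) hr
  have hFT : F ⊆ T := fun e he => (hF.subset_edgeSet he).2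
  have : T = F := by
    refine Set.Subset.antisymm (fun e he => ?_) hFT
    obtain ⟨x, y, hl⟩ := exists_isLink_of_mem_edgeSet (hT he)
    exact hF.of_restrict.edge_mem_of_isForest hFT h.2 he hl.left_mem hl.right_mem hl
  exact this ▸ hF.of_restrict

/-- The edge sets of the spanning trees of a multigraph. -/
def treeSets (H : Graph α β) : Set (Set β) := {T | T ⊆ H.edgeSet ∧ (H.restrict T).IsTree}

lemma mem_treeSets_iff [Finite α] (hr : r ∈ H.vertexSet) :
    T ∈ H.treeSets ↔ H.IsArb r H.vertexSet T :=
  ⟨fun h => h.2.isArb h.1 hr, fun h => ⟨h.subset_edgeSet, h.isTree rfl⟩⟩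

lemma isSpanningTreeOf_restrict_iff :
    (H.restrict T).IsSpanningTreeOf H ↔ (H.restrict T).IsTree :=
  ⟨fun h => h.2, fun h => ⟨⟨restrict_le, rfl⟩, h⟩⟩

lemma IsConn.treeSets_nonempty [Finite α] (h : H.IsConn) : H.treeSets.Nonempty := by
  obtain ⟨r, hr⟩ := h.1
  obtain ⟨F, hF⟩ := h.exists_isArb hr
  exact ⟨F, (mem_treeSets_iff hr).2 hF⟩

/-! ### Orientation of a tree towards its root -/

/-- A parent function on the vertices of a tree with edge set `T`, rooted at `r`. -/
structure Orientation (H : Graph α β) (r : α) (T : Set β) where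
  par : α → Option (β × α)
  depth : α → ℕ
  ne_root : ∀ {x e y}, par x = some (e, y) → x ≠ r
  edge_mem : ∀ {x e y}, par x = some (e, y) → e ∈ T
  isLink : ∀ {x e y}, par x = some (e, y) → H.IsLink e x y
  depth_lt : ∀ {x e y}, par x = some (e, y) → depth y < depth x
  exists_of_edge : ∀ e ∈ T, ∃ x y, par x = some (e, y)

/-- The parent of a leaf is the vertex it is attached to, and its depth is one more. The induction
also carries that parents and children lie in `A`, so that the update at a new leaf leaves the older
data intact. -/
lemma IsArb.exists_orientation (h : H.IsArb r A F) :
    ∃ o : H.Orientation r F, ∀ x, x ∈ A → x ≠ r → ∃ e y, o.par x = some (e, y) := by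
  classical
  suffices ∃ o : H.Orientation r F, (∀ x, x ∈ A → x ≠ r → ∃ e y, o.par x = some (e, y)) ∧
      ∀ x e y, o.par x = some (e, y) → x ∈ A ∧ y ∈ A from let ⟨o, ho, _⟩ := this; ⟨o, ho⟩
  induction h with
  | root =>
    refine ⟨⟨fun _ => none, fun _ => 0, ?_, ?_, ?_, ?_, ?_⟩, ?_, ?_⟩ <;> simp
  | @attach A F e₀ x₀ y₀ h hx₀ hy₀ hl ih =>
    obtain ⟨o, h1, h2⟩ := ih
    have hne : ∀ {z}, z ∈ A → z ≠ x₀ := fun hz hzx => hx₀ (hzx ▸ hz)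
    have key : ∀ {x e y}, Function.update o.par x₀ (some (e₀, y₀)) x = some (e, y) →
        (x = x₀ ∧ e = e₀ ∧ y = y₀) ∨ (x ≠ x₀ ∧ o.par x = some (e, y)) := by
      intro x e y hxe
      by_cases hx : x = x₀
      · subst hx
        simp only [Function.update_self, Option.some.injEq, Prod.mk.injEq] at hxe
        exact Or.inl ⟨rfl, hxe.1.symm, hxe.2.symm⟩
      · exact Or.inr ⟨hx, by simpa [hx] using hxe⟩
    refine ⟨⟨Function.update o.par x₀ (some (e₀, y₀)), Function.update o.depth x₀ (o.depth y₀ + 1),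
      ?_, ?_, ?_, ?_, ?_⟩, ?_, ?_⟩
    · intro x e y hxe
      rcases key hxe with ⟨rfl, rfl, rfl⟩ | ⟨-, h3⟩
      · exact (hne h.root_mem).symm
      · exact o.ne_root h3
    · intro x e y hxe
      rcases key hxe with ⟨rfl, rfl, rfl⟩ | ⟨-, h3⟩
      · exact Or.inl rfl
      · exact Or.inr (o.edge_mem h3)
    · intro x e y hxe
      rcases key hxe with ⟨rfl, rfl, rfl⟩ | ⟨-, h3⟩
      · exact hl
      · exact o.isLink h3
    · intro x e y hxe
      rcases key hxe with ⟨rfl, rfl, rfl⟩ | ⟨hx, h3⟩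
      · simp [hne hy₀]
      · simpa [hx, hne (h2 _ _ _ h3).2] using o.depth_lt h3
    · rintro e (rfl | he)
      · exact ⟨x₀, y₀, by simp⟩
      · obtain ⟨x, y, hxy⟩ := o.exists_of_edge e he
        exact ⟨x, y, by simp [hne (h2 _ _ _ hxy).1, hxy]⟩
    · rintro x (rfl | hx) hxr
      · exact ⟨e₀, y₀, by simp⟩
      · obtain ⟨e, y, hxy⟩ := h1 x hx hxr
        exact ⟨e, y, by simp [hne hx, hxy]⟩
    · intro x e y hxe
      rcases key hxe with ⟨rfl, rfl, rfl⟩ | ⟨-, h3⟩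
      · exact ⟨Or.inl rfl, Or.inr hy₀⟩
      · exact ⟨Or.inr (h2 _ _ _ h3).1, Or.inr (h2 _ _ _ h3).2⟩

namespace Orientation

variable (o : H.Orientation r T)

/-- A subtree that contains the root is closed under taking parents. -/
lemma closed (h : H.IsArb r A F) (hFT : F ⊆ T) {x : α} (hx : x ∈ A) {e : β} {y : α}
    (hp : o.par x = some (e, y)) : e ∈ F ∧ y ∈ A := by
  induction h generalizing x e y with
  | root => exact absurd hx (o.ne_root hp)
  | @attach A F e₀ x₀ y₀ h hx₀ hy₀ hl ih =>
    have ih' := fun {x} (hx : x ∈ A) {e y} => ih (fun e he => hFT (Or.inr he)) hx (e := e) (y := y)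
    rcases hx with rfl | hx
    · obtain ⟨x₁, y₁, h1⟩ := o.exists_of_edge e₀ (hFT (Or.inl rfl))
      rcases (o.isLink h1).eq_and_eq_or_eq_and_eq hl with ⟨rfl, rfl⟩ | ⟨rfl, rfl⟩
      · rw [hp] at h1
        obtain ⟨rfl, rfl⟩ : e = e₀ ∧ y = y₁ := by simpa using h1
        exact ⟨Or.inl rfl, Or.inr hy₀⟩
      · exact absurd (ih' hy₀ h1).2 hx₀
    · exact ⟨Or.inr (ih' hx hp).1, Or.inr (ih' hx hp).2⟩

/-- With the opposite orientation `y` would have its parent `x` outside a subtree that is closed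
under parents. -/
lemma par_eq_of_isLink (h : H.IsArb r A F) (hFT : F ⊆ T) {x y : α} {e : β} (hx : x ∉ A)
    (hy : y ∈ A) (hl : H.IsLink e x y) (he : e ∈ T) : o.par x = some (e, y) := by
  obtain ⟨x₁, y₁, h1⟩ := o.exists_of_edge e he
  rcases (o.isLink h1).eq_and_eq_or_eq_and_eq hl with ⟨rfl, rfl⟩ | ⟨rfl, rfl⟩
  · exact h1
  · exact absurd (o.closed h hFT hy h1).2 hx

end Orientation

end Graph

/-! ### The Laplacian and the Dirichlet problem -/

namespace Graph

universe u v w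

variable {α : Type u} {β : Type w} [Fintype α] [Fintype β] {H : Graph α β} {B : Set α}

open Classical in
lemma mem_walkSteps {x : α} {p : β × α} : p ∈ H.walkSteps x ↔ H.IsLink p.1 x p.2 := by
  simp [walkSteps]

/-- The graph Laplacian. -/
noncomputable def lap (H : Graph α β) (φ : α → ℝ) (x : α) : ℝ :=
  ∑ p ∈ H.walkSteps x, (φ x - φ p.2)

lemma lap_eq (φ : α → ℝ) (x : α) :
    H.lap φ x = (H.walkSteps x).card * φ x - ∑ p ∈ H.walkSteps x, φ p.2 := by
  simp [lap]

open Classical in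
/-- The matrix of the Dirichlet problem with boundary `B`: rows of the Laplacian at the vertices
outside `B`, rows of the identity elsewhere. -/
noncomputable def dirichletMatrix (H : Graph α β) (B : Set α) : Matrix α α ℝ :=
  Matrix.of fun x y => if x ∈ H.vertexSet \ B then
    ∑ p ∈ H.walkSteps x, ((if y = x then 1 else 0) - if y = p.2 then 1 else 0)
  else if y = x then 1 else 0

open Classical in
lemma dirichletMatrix_mulVec_of_mem (φ : α → ℝ) {x : α} (hx : x ∈ H.vertexSet \ B) :
    (H.dirichletMatrix B).mulVec φ x = H.lap φ x := by
  simp only [Matrix.mulVec, dotProduct, dirichletMatrix, Matrix.of_apply, if_pos hx, lap,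
    Finset.sum_mul, sub_mul, ite_mul, one_mul, zero_mul]
  rw [Finset.sum_comm]
  simp [Finset.sum_sub_distrib]

open Classical in
lemma dirichletMatrix_mulVec_of_notMem (φ : α → ℝ) {x : α} (hx : x ∉ H.vertexSet \ B) :
    (H.dirichletMatrix B).mulVec φ x = φ x := by
  simp only [Matrix.mulVec, dotProduct, dirichletMatrix, Matrix.of_apply, if_neg hx]
  simp

/-- The maximum principle. -/
lemma nonpos_of_lap_eq_zero (hH : H.IsConn) (hB : (B ∩ H.vertexSet).Nonempty) {φ : α → ℝ}
    (h0 : ∀ x, x ∉ H.vertexSet \ B → φ x = 0) (h1 : ∀ x ∈ H.vertexSet \ B, H.lap φ x = 0) (x : α) :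
    φ x ≤ 0 := by
  obtain ⟨b, hbB, hbV⟩ := hB
  have : Nonempty α := ⟨x⟩
  obtain ⟨m, hm⟩ := Finite.exists_max φ
  suffices φ m = 0 from (hm x).trans this.le
  by_contra hne
  have hmV : m ∈ H.vertexSet := by
    by_contra h
    exact hne (h0 m fun h' => h h'.1)
  -- Where the Laplacian vanishes at a maximum, all neighbours share the maximal value. A walk to
  -- `b` would thus carry a nonzero value to the boundary.
  have key : ∀ z, Relation.ReflTransGen H.Adj m z → φ z = φ m := by
    intro z hz
    induction hz with
    | refl => rfl
    | @tail y z _ hyz ih =>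
      obtain ⟨e, he⟩ := hyz
      have hy : y ∈ H.vertexSet \ B := by
        by_contra h
        exact hne (ih ▸ h0 y h)
      have h2 := (Finset.sum_eq_zero_iff_of_nonneg (fun p _ => by
        simpa [ih] using hm p.2)).1 (h1 y hy) (e, z) (mem_walkSteps.2 he)
      simp only at h2
      linarith
  exact hne ((key b (hH.2 m hmV b hbV)).symm.trans (h0 b fun h => h.2 hbB))

-- A kernel vector solves the Dirichlet problem with zero boundary values; the maximum principle for
-- it and for its negative makes it vanish.
open Classical in
lemma det_dirichletMatrix_ne_zero (hH : H.IsConn) (hB : (B ∩ H.vertexSet).Nonempty) :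
    (H.dirichletMatrix B).det ≠ 0 := by
  intro hdet
  obtain ⟨φ, hne, hφ⟩ := Matrix.exists_mulVec_eq_zero_iff.2 hdet
  have h0 : ∀ x, x ∉ H.vertexSet \ B → φ x = 0 := fun x hx => by
    rw [← dirichletMatrix_mulVec_of_notMem φ hx, hφ]; rfl
  have h1 : ∀ x ∈ H.vertexSet \ B, H.lap φ x = 0 := fun x hx => by
    rw [← dirichletMatrix_mulVec_of_mem φ hx, hφ]; rfl
  refine hne (funext fun x => le_antisymm (nonpos_of_lap_eq_zero hH hB h0 h1 x) ?_)
  have := nonpos_of_lap_eq_zero hH hB (φ := -φ) (fun x hx => by simp [h0 x hx])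
    (fun x hx => by
      have := h1 x hx
      simp only [lap_eq, Pi.neg_apply, Finset.sum_neg_distrib] at this ⊢
      linarith) x
  simpa using this

open Classical in
lemma det_dirichletMatrix_of_subset (hB : H.vertexSet ⊆ B) : (H.dirichletMatrix B).det = 1 := by
  have : H.dirichletMatrix B = 1 := by
    ext x y
    have hx : x ∉ H.vertexSet \ B := fun h => h.2 (hB h.1)
    simp only [dirichletMatrix, Matrix.of_apply, if_neg hx, Matrix.one_apply, eq_comm]
  rw [this, Matrix.det_one]

open Classical in
/-- The probability, as a function of the starting point, that the random walk hits `v` before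
`B`. -/
noncomputable def hitProb (H : Graph α β) (B : Set α) (v : α) : α → ℝ :=
  (H.dirichletMatrix (insert v B))⁻¹.mulVec (Pi.single v 1)

open Classical in
/-- The expected time at which the random walk hits `B`. -/
noncomputable def hitTime (H : Graph α β) (B : Set α) : α → ℝ :=
  (H.dirichletMatrix B)⁻¹.mulVec
    fun x => if x ∈ H.vertexSet \ B then ((H.walkSteps x).card : ℝ) else 0

open Classical in
lemma dirichletMatrix_mulVec_inv (hH : H.IsConn) (hB : (B ∩ H.vertexSet).Nonempty) (φ : α → ℝ) :
    (H.dirichletMatrix B).mulVec ((H.dirichletMatrix B)⁻¹.mulVec φ) = φ := by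
  rw [Matrix.mulVec_mulVec, Matrix.mul_nonsing_inv _ (det_dirichletMatrix_ne_zero hH hB).isUnit,
    Matrix.one_mulVec]

lemma hitTime_of_mem (hH : H.IsConn) (hB : (B ∩ H.vertexSet).Nonempty) {x : α} (hx : x ∈ B) :
    H.hitTime B x = 0 := by
  classical
  have hx' : x ∉ H.vertexSet \ B := fun h => h.2 hx
  rw [← dirichletMatrix_mulVec_of_notMem (H.hitTime B) hx', hitTime, dirichletMatrix_mulVec_inv hH hB,
    if_neg hx']

lemma lap_hitTime (hH : H.IsConn) (hB : (B ∩ H.vertexSet).Nonempty) {x : α}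
    (hx : x ∈ H.vertexSet \ B) : H.lap (H.hitTime B) x = (H.walkSteps x).card := by
  classical
  rw [← dirichletMatrix_mulVec_of_mem _ hx, hitTime, dirichletMatrix_mulVec_inv hH hB, if_pos hx]

open Classical in
lemma hitProb_of_mem_insert (hH : H.IsConn) {v : α} (hv : v ∈ H.vertexSet) {x : α}
    (hx : x ∈ insert v B) : H.hitProb B v x = if x = v then 1 else 0 := by
  rw [← dirichletMatrix_mulVec_of_notMem (H := H) (B := insert v B) (x := x) (H.hitProb B v)
      (fun h => h.2 hx), hitProb,
    dirichletMatrix_mulVec_inv hH ⟨v, Or.inl rfl, hv⟩, Pi.single_apply]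

lemma hitProb_self (hH : H.IsConn) {v : α} (hv : v ∈ H.vertexSet) : H.hitProb B v v = 1 := by
  simpa using hitProb_of_mem_insert (B := B) hH hv (Or.inl rfl)

lemma hitProb_of_mem (hH : H.IsConn) {v : α} (hv : v ∈ H.vertexSet) {x : α} (hx : x ∈ B)
    (hxv : x ≠ v) : H.hitProb B v x = 0 := by
  simpa [hxv] using hitProb_of_mem_insert (B := B) hH hv (Or.inr hx)

lemma lap_hitProb (hH : H.IsConn) {v : α} (hv : v ∈ H.vertexSet) {x : α} (hx : x ∈ H.vertexSet)
    (hxB : x ∉ B) (hxv : x ≠ v) : H.lap (H.hitProb B v) x = 0 := by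
  classical
  rw [← dirichletMatrix_mulVec_of_mem (B := insert v B) _ ⟨hx, by simp [hxB, hxv]⟩, hitProb,
    dirichletMatrix_mulVec_inv hH ⟨v, Or.inl rfl, hv⟩, Pi.single_apply, if_neg hxv]

open Classical in
/-- Cramer's rule: the escape probability at `v`, times the degree, is a ratio of determinants. -/
lemma lap_hitProb_self_mul_det (hH : H.IsConn) {v : α} (hv : v ∈ H.vertexSet) (hvB : v ∉ B) :
    H.lap (H.hitProb B v) v * (H.dirichletMatrix (insert v B)).det =
      (H.dirichletMatrix B).det := by
  set M := H.dirichletMatrix (insert v B) with hM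
  have hdet : M.det ≠ 0 := det_dirichletMatrix_ne_zero hH ⟨v, Or.inl rfl, hv⟩
  -- Making `v` a boundary vertex changes only the row at `v`.
  have hrow : H.dirichletMatrix B = M.updateRow v (H.dirichletMatrix B v) := by
    ext x y
    by_cases hx : x = v
    · rw [hx, Matrix.updateRow_self]
    · rw [Matrix.updateRow_ne hx, hM]
      simp only [dirichletMatrix, Matrix.of_apply, Set.mem_sdiff, Set.mem_insert_iff, hx, false_or]
  rw [← dirichletMatrix_mulVec_of_mem (B := B) _ ⟨hv, hvB⟩]
  -- Expanded along the new row, the determinant pairs this row with column `v` of the adjugate of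
  -- `M`, which is `M.det` times `hitProb`.
  conv_rhs => rw [hrow, ← Matrix.det_transpose, ← Matrix.updateCol_transpose,
    ← Matrix.cramer_apply, Matrix.cramer_eq_adjugate_mulVec, ← Matrix.adjugate_transpose]
  have hinv : M⁻¹ = M.det⁻¹ • M.adjugate := by rw [Matrix.inv_def, Ring.inverse_eq_inv']
  simp only [hitProb, ← hM, hinv, Matrix.mulVec, dotProduct, Matrix.smul_apply, smul_eq_mul,
    Matrix.transpose_apply, Pi.single_apply, mul_ite, mul_one, mul_zero, Finset.sum_ite_eq',
    Finset.mem_univ, if_true, Finset.sum_mul]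
  refine Finset.sum_congr rfl fun y _ => ?_
  field_simp

end Graph

/-! ### Halting probabilities of Markov chains -/

open scoped Topology

namespace PMF

universe u v

variable {σ : Type u} {ρ : Type v}

/-- The expectation of `f` under `p`, restricted to a finite set. -/
noncomputable def expOn (X : Finset σ) (p : PMF σ) (f : σ → ℝ) : ℝ :=
  ∑ s ∈ X, (p s).toReal * f s

lemma expOn_mono {X : Finset σ} (p : PMF σ) {f g : σ → ℝ} (h : ∀ s ∈ X, f s ≤ g s) :
    expOn X p f ≤ expOn X p g :=
  Finset.sum_le_sum fun s hs => mul_le_mul_of_nonneg_left (h s hs) ENNReal.toReal_nonneg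

lemma expOn_congr {X : Finset σ} (p : PMF σ) {f g : σ → ℝ} (h : ∀ s ∈ X, f s = g s) :
    expOn X p f = expOn X p g :=
  Finset.sum_congr rfl fun s hs => by rw [h s hs]

lemma expOn_sub (X : Finset σ) (p : PMF σ) (f g : σ → ℝ) :
    expOn X p (fun s => f s - g s) = expOn X p f - expOn X p g := by
  simp [expOn, mul_sub]

lemma expOn_const_mul (X : Finset σ) (p : PMF σ) (c : ℝ) (f : σ → ℝ) :
    expOn X p (fun s => c * f s) = c * expOn X p f := by
  simp only [expOn, Finset.mul_sum]
  exact Finset.sum_congr rfl fun s _ => by ring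

lemma expOn_sum {ι : Type*} (X : Finset σ) (p : PMF σ) (I : Finset ι) (f : ι → σ → ℝ) :
    expOn X p (fun s => ∑ i ∈ I, f i s) = ∑ i ∈ I, expOn X p (f i) := by
  simp only [expOn, Finset.mul_sum]
  exact Finset.sum_comm

lemma expOn_bind {X : Finset σ} {Y : Finset ρ} (p : PMF ρ) (q : ρ → PMF σ) (f : σ → ℝ)
    (hp : ∀ s ∈ p.support, s ∈ Y) :
    expOn X (p.bind q) f = expOn Y p fun s => expOn X (q s) f := by
  have h1 : ∀ s', (p.bind q s').toReal = ∑ s ∈ Y, (p s).toReal * (q s s').toReal := by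
    intro s'
    rw [bind_apply, tsum_eq_sum (s := Y), ENNReal.toReal_sum]
    · simp [ENNReal.toReal_mul]
    · exact fun s _ => ENNReal.mul_ne_top (p.apply_ne_top s) ((q s).apply_ne_top s')
    · intro s hs
      rw [(apply_eq_zero_iff p s).2 fun h => hs (hp s h), zero_mul]
  simp only [expOn, h1, Finset.sum_mul, Finset.mul_sum]
  rw [Finset.sum_comm]
  exact Finset.sum_congr rfl fun _ _ => Finset.sum_congr rfl fun _ _ => by ring

lemma expOn_pure {X : Finset σ} {a : σ} (ha : a ∈ X) (f : σ → ℝ) : expOn X (pure a) f = f a := by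
  classical
  rw [expOn, Finset.sum_eq_single a]
  · simp
  · intro b _ hb
    simp [pure_apply, hb]
  · exact fun h => absurd ha h

lemma expOn_map_uniformOfFinset {X : Finset σ} {Y : Finset ρ} (hY : Y.Nonempty) (m : ρ → σ)
    (hm : ∀ p ∈ Y, m p ∈ X) (f : σ → ℝ) :
    expOn X ((uniformOfFinset Y hY).map m) f = (Y.card : ℝ)⁻¹ * ∑ p ∈ Y, f (m p) := by
  rw [map, expOn_bind (Y := Y) _ _ _ fun s hs => by simpa using hs, expOn, Finset.mul_sum]
  refine Finset.sum_congr rfl fun p hp => ?_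
  rw [Function.comp_apply, expOn_pure (hm p hp), uniformOfFinset_apply_of_mem _ hp]
  simp

lemma toOuterMeasure_eq_ofReal_expOn {X : Finset σ} {p : PMF σ} (hp : ∀ s ∈ p.support, s ∈ X)
    (D : Set σ) : p.toOuterMeasure D = ENNReal.ofReal (expOn X p (D.indicator 1)) := by
  classical
  rw [toOuterMeasure_apply, tsum_eq_sum (s := X), expOn, ENNReal.ofReal_sum_of_nonneg]
  · refine Finset.sum_congr rfl fun s _ => ?_
    by_cases hs : s ∈ D <;> simp [hs, p.apply_ne_top]
  · exact fun s _ => mul_nonneg ENNReal.toReal_nonneg (Set.indicator_nonneg (by simp) _)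
  · intro s hs
    simp [(apply_eq_zero_iff p s).2 fun h => hs (hp s h)]

lemma expOn_one {X : Finset σ} {p : PMF σ} (hp : ∀ s ∈ p.support, s ∈ X) :
    expOn X p (fun _ => 1) = 1 := by
  have h1 := toOuterMeasure_eq_ofReal_expOn hp Set.univ
  rw [(toOuterMeasure_apply_eq_one_iff _ _).2 (Set.subset_univ _), Set.indicator_univ] at h1
  exact (ENNReal.ofReal_eq_one.1 h1.symm)

/-- A bounded harmonic function of a Markov chain that halts almost surely, and that is the
indicator function of `D` at the states where the chain halts, is the probability of halting
in `D`. The hypothesis on `τ` bounds the expected time until the chain halts. -/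
theorem iSup_toOuterMeasure_eq {X : Finset σ} {step : σ → PMF σ} {run : ℕ → PMF σ} {s₀ : σ}
    (run_zero : run 0 = pure s₀) (run_succ : ∀ k, run (k + 1) = (run k).bind step) (hs₀ : s₀ ∈ X)
    (hX : ∀ s ∈ X, ∀ s' ∈ (step s).support, s' ∈ X) {N D : Set σ} (hDN : D ⊆ N)
    (hN : ∀ s ∈ X, s ∈ N → step s = pure s) {f τ : σ → ℝ}
    (hf : ∀ s ∈ X, expOn X (step s) f = f s) (hfD : ∀ s ∈ X, s ∈ N → f s = D.indicator 1 s)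
    (hτ : ∀ s ∈ X, s ∉ N → expOn X (step s) τ ≤ τ s - 1) :
    0 ≤ f s₀ ∧ ⨆ k, (run k).toOuterMeasure D = ENNReal.ofReal (f s₀) := by
  have supp : ∀ k, ∀ s ∈ (run k).support, s ∈ X := by
    intro k
    induction k with
    | zero => simp [run_zero, hs₀]
    | succ k ih =>
      intro s hs
      rw [run_succ, mem_support_bind_iff] at hs
      obtain ⟨s', hs', hs⟩ := hs
      exact hX s' (ih s' hs') s hs
  have succ : ∀ k g, expOn X (run (k + 1)) g = expOn X (run k) fun s => expOn X (step s) g :=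
    fun k g => by rw [run_succ, expOn_bind _ _ _ (supp k)]
  have hf' : ∀ k, expOn X (run k) f = f s₀ := by
    intro k
    induction k with
    | zero => rw [run_zero, expOn_pure hs₀]
    | succ k ih => rw [succ, expOn_congr _ hf, ih]
  -- `a k` is the probability of being in `D` at time `k`, and `b k` that of not having halted.
  set a : ℕ → ℝ := fun k => expOn X (run k) (D.indicator 1) with ha
  set b : ℕ → ℝ := fun k => expOn X (run k) (Nᶜ.indicator 1) with hb
  have ind_nonneg : ∀ (E : Set σ) s, (0 : ℝ) ≤ E.indicator 1 s :=
    fun E s => Set.indicator_nonneg (by simp) s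
  have exp_nonneg : ∀ (p : PMF σ) (E : Set σ), 0 ≤ expOn X p (E.indicator 1) := fun p E =>
    Finset.sum_nonneg fun s _ => mul_nonneg ENNReal.toReal_nonneg (ind_nonneg E s)
  have ha_mono : Monotone a := by
    refine monotone_nat_of_le_succ fun k => ?_
    simp only [ha, succ]
    refine expOn_mono _ fun s hs => ?_
    by_cases hsD : s ∈ D
    · rw [hN s hs (hDN hsD), expOn_pure hs]
    · rw [Set.indicator_of_notMem hsD]
      exact exp_nonneg _ _
  obtain ⟨C, hC⟩ : ∃ C, ∀ s ∈ X, |τ s| ≤ C := by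
    obtain ⟨C, hC⟩ := (X.finite_toSet.image fun s => |τ s|).bddAbove
    exact ⟨C, fun s hs => hC ⟨s, hs, rfl⟩⟩
  -- Each step costs `τ` at least `b k` on average. As `τ` is bounded below on `X`, the sum of the
  -- `b k` is finite, and hence `b k` tends to zero.
  have hb_sum : ∀ k, expOn X (run k) τ + ∑ j ∈ Finset.range k, b j ≤ τ s₀ := by
    intro k
    induction k with
    | zero => simp [run_zero, expOn_pure hs₀]
    | succ k ih =>
      have h1 : expOn X (run (k + 1)) τ ≤ expOn X (run k) τ - b k := by
        rw [succ, hb, ← expOn_sub]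
        refine expOn_mono _ fun s hs => ?_
        by_cases hsN : s ∈ N
        · rw [hN s hs hsN, expOn_pure hs]
          simp [hsN]
        · simpa [hsN] using hτ s hs hsN
      rw [Finset.sum_range_succ]
      linarith
  have hb_summable : Summable b := by
    refine summable_of_sum_range_le (c := τ s₀ + C) (fun k => exp_nonneg _ _) fun k => ?_
    have h1 : expOn X (run k) (fun _ => -C * 1) ≤ expOn X (run k) τ :=
      expOn_mono _ fun s hs => by simpa using neg_le_of_abs_le (hC s hs)
    rw [expOn_const_mul] at h1
    rw [expOn_one (supp k)] at h1
    linarith [hb_sum k]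
  obtain ⟨C', hC'⟩ : ∃ C', ∀ s ∈ X, |f s - D.indicator 1 s| ≤ C' := by
    obtain ⟨C', hC'⟩ := (X.finite_toSet.image fun s => |f s - D.indicator 1 s|).bddAbove
    exact ⟨C', fun s hs => hC' ⟨s, hs, rfl⟩⟩
  have hab : ∀ k, |f s₀ - a k| ≤ C' * b k := by
    intro k
    -- The function `f` and the indicator of `D` differ only at states that have not halted.
    have key : ∀ s ∈ X, |f s - D.indicator 1 s| ≤ C' * Nᶜ.indicator 1 s := by
      intro s hs
      by_cases hsN : s ∈ N
      · simp [hsN, hfD s hs hsN]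
      · simpa [hsN] using hC' s hs
    rw [← hf' k, ha, hb, ← expOn_sub, ← expOn_const_mul]
    refine abs_le.2 ⟨?_, expOn_mono _ fun s hs => (abs_le.1 (key s hs)).2⟩
    have h1 := expOn_mono (run k) (X := X) (f := fun s => (-1) * (C' * Nᶜ.indicator 1 s))
      (g := fun s => f s - D.indicator 1 s) fun s hs => by linarith [(abs_le.1 (key s hs)).1]
    rw [expOn_const_mul] at h1
    linarith
  have ha_lim : Filter.Tendsto a Filter.atTop (𝓝 (f s₀)) := by
    have h1 := (hb_summable.tendsto_atTop_zero.const_mul C')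
    rw [mul_zero] at h1
    have h2 := squeeze_zero_norm (f := fun k => f s₀ - a k) hab h1
    simpa using (tendsto_const_nhds (x := f s₀)).sub h2
  refine ⟨ge_of_tendsto' ha_lim fun k => exp_nonneg _ _, ?_⟩
  have h1 : ∀ k, (run k).toOuterMeasure D = ENNReal.ofReal (a k) := fun k =>
    toOuterMeasure_eq_ofReal_expOn (supp k) D
  simp only [h1]
  exact tendsto_nhds_unique
    (tendsto_atTop_iSup fun i j hij => ENNReal.ofReal_le_ofReal (ha_mono hij))
    ((ENNReal.continuous_ofReal.tendsto _).comp ha_lim)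

end PMF

/-! ### States of Wilson's algorithm and their invariants -/

namespace Graph

universe u v w

variable {α : Type u} {β : Type w} {H : Graph α β} {r : α} {A : Set α} {F T : Set β}

/-- The vertices that a loop-erased path has left. -/
def pathVerts (l : List (α × β)) : Set α := {x | x ∈ l.map Prod.fst}

/-- The edges of a loop-erased path. -/
def pathEdges (l : List (α × β)) : Set β := {e | e ∈ l.map Prod.snd}

lemma pathVerts_nil : pathVerts ([] : List (α × β)) = ∅ := by simp [pathVerts]

lemma pathVerts_cons (v : α) (e : β) (l : List (α × β)) :
    pathVerts ((v, e) :: l) = insert v (pathVerts l) := by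
  ext; simp [pathVerts]

lemma pathEdges_nil : pathEdges ([] : List (α × β)) = ∅ := by simp [pathEdges]

lemma pathEdges_cons (v : α) (e : β) (l : List (α × β)) :
    pathEdges ((v, e) :: l) = insert e (pathEdges l) := by
  ext; simp [pathEdges]

lemma union_pathVerts_cons (A : Set α) (v : α) (e : β) (l : List (α × β)) :
    A ∪ pathVerts ((v, e) :: l) = insert v (A ∪ pathVerts l) := by
  rw [pathVerts_cons, Set.union_insert]

/-- The list `l`, latest vertex first, is a self-avoiding path in `H` off `A` that leads to `y`. -/
def IsPathTo (H : Graph α β) (A : Set α) : List (α × β) → α → Prop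
  | [], _ => True
  | (v, e) :: l, y => H.IsLink e v y ∧ v ∉ A ∧ v ∉ pathVerts l ∧ IsPathTo H A l v

lemma IsPathTo.mem_diff {l : List (α × β)} {y : α} (h : H.IsPathTo A l y) {x : α}
    (hx : x ∈ pathVerts l) : x ∈ H.vertexSet \ A := by
  induction l generalizing y with
  | nil => simp [pathVerts] at hx
  | cons a l ih =>
    obtain ⟨v, e⟩ := a
    rw [pathVerts_cons] at hx
    rcases hx with rfl | hx
    · exact ⟨h.1.left_mem, h.2.1⟩
    · exact ih h.2.2.2 hx

lemma IsPathTo.nodup {l : List (α × β)} {y : α} (h : H.IsPathTo A l y) :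
    (l.map Prod.fst).Nodup := by
  induction l generalizing y with
  | nil => simp
  | cons a l ih =>
    obtain ⟨v, e⟩ := a
    exact List.nodup_cons.2 ⟨h.2.2.1, ih h.2.2.2⟩

lemma IsPathTo.insert {l : List (α × β)} {y z : α} (h : H.IsPathTo A l y) (hz : z ∉ pathVerts l) :
    H.IsPathTo (insert z A) l y := by
  induction l generalizing y with
  | nil => trivial
  | cons a l ih =>
    obtain ⟨v, e⟩ := a
    rw [pathVerts_cons] at hz
    refine ⟨h.1, ?_, h.2.2.1, ih h.2.2.2 fun hz' => hz (Or.inr hz')⟩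
    rintro (rfl | hv)
    · exact hz (Or.inl rfl)
    · exact h.2.1 hv

/-- The list has the latest vertex first, so its head is the leaf next to the tree, and each later
entry is a leaf at the one before it. -/
lemma IsArb.union_path {l : List (α × β)} {y : α} (hA : H.IsArb r A F) (hy : y ∈ A)
    (h : H.IsPathTo A l y) : H.IsArb r (A ∪ pathVerts l) (F ∪ pathEdges l) := by
  induction l generalizing y A F with
  | nil => simpa [pathVerts_nil, pathEdges_nil] using hA
  | cons a l ih =>
    obtain ⟨v, e⟩ := a
    have := ih (hA.attach h.2.1 hy h.1) (Or.inl rfl) (h.2.2.2.insert h.2.2.1)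
    rwa [Set.insert_union, Set.insert_union, ← Set.union_insert, ← Set.union_insert,
      ← pathVerts_cons v e, ← pathEdges_cons v e] at this

open Classical in
/-- The path up to the first visit to `z`. -/
noncomputable def eraseLoop (l : List (α × β)) (z : α) : List (α × β) :=
  (l.dropWhile fun a => decide (a.1 ≠ z)).tail

lemma eraseLoop_cons_self (l : List (α × β)) (z : α) (e : β) : eraseLoop ((z, e) :: l) z = l := by
  simp [eraseLoop]

lemma eraseLoop_cons_of_ne (l : List (α × β)) {v z : α} (e : β) (h : v ≠ z) :
    eraseLoop ((v, e) :: l) z = eraseLoop l z := by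
  simp [eraseLoop, h]

lemma IsPathTo.eraseLoop {l : List (α × β)} {y z : α} (h : H.IsPathTo A l y)
    (hz : z ∈ pathVerts l) :
    H.IsPathTo A (eraseLoop l z) z ∧ z ∉ pathVerts (Graph.eraseLoop l z) := by
  induction l generalizing y with
  | nil => simp [pathVerts] at hz
  | cons a l ih =>
    obtain ⟨v, e⟩ := a
    by_cases hvz : v = z
    · subst hvz
      rw [eraseLoop_cons_self]
      exact ⟨h.2.2.2, h.2.2.1⟩
    · rw [eraseLoop_cons_of_ne l e hvz]
      rw [pathVerts_cons] at hz
      exact ih h.2.2.2 (hz.resolve_left (Ne.symm hvz))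

/-- The invariants of the state of Wilson's algorithm. -/
structure WilsonState.Valid (s : WilsonState α β) (H : Graph α β) (r : α) : Prop where
  arb : H.IsArb r s.verts s.edges
  cur_mem : s.cur ∈ H.vertexSet
  path : H.IsPathTo s.verts s.path s.cur
  cur_notMem : s.cur ∉ pathVerts s.path

/-- The state after the current path has been added to the tree. -/
noncomputable def WilsonState.absorb (s : WilsonState α β) {H : Graph α β} (R : WilsonRule H) :
    WilsonState α β :=
  open Classical in
  ⟨s.verts ∪ pathVerts s.path, s.edges ∪ pathEdges s.path, [],
    if s.verts ∪ pathVerts s.path = H.vertexSet then s.cur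
    else R.next (s.verts ∪ pathVerts s.path) (s.edges ∪ pathEdges s.path)⟩

section step

variable [Fintype α] [Fintype β] {R : WilsonRule H} {s : WilsonState α β}

lemma wilsonStep_of_mem (h : s.cur ∈ s.verts) : wilsonStep H R s = PMF.pure (s.absorb R) := by
  rw [wilsonStep, if_pos h]
  rfl

lemma wilsonStep_of_notMem (h : s.cur ∉ s.verts) (hs : (H.walkSteps s.cur).Nonempty) :
    wilsonStep H R s = (PMF.uniformOfFinset (H.walkSteps s.cur) hs).map s.move := by
  rw [wilsonStep, if_neg h, dif_pos hs]

end step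

open Classical in
lemma move_eq (s : WilsonState α β) (p : β × α) : s.move p = ⟨s.verts, s.edges,
    if p.2 ∈ pathVerts ((s.cur, p.1) :: s.path) then eraseLoop ((s.cur, p.1) :: s.path) p.2
    else (s.cur, p.1) :: s.path, p.2⟩ := by
  simp only [WilsonState.move, eraseLoop, pathVerts, Set.mem_ofPred_eq]
  congr

namespace WilsonState.Valid

variable {s : WilsonState α β}

lemma path_cons (hs : s.Valid H r) (hc : s.cur ∉ s.verts) {p : β × α}
    (hp : H.IsLink p.1 s.cur p.2) : H.IsPathTo s.verts ((s.cur, p.1) :: s.path) p.2 :=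
  ⟨hp, hc, hs.cur_notMem, hs.path⟩

lemma move (hs : s.Valid H r) (hc : s.cur ∉ s.verts) {p : β × α} (hp : H.IsLink p.1 s.cur p.2) :
    (s.move p).Valid H r := by
  classical
  have h := hs.path_cons hc hp
  rw [move_eq]
  by_cases hl : p.2 ∈ pathVerts ((s.cur, p.1) :: s.path)
  · rw [if_pos hl]
    exact ⟨hs.arb, hp.right_mem, (h.eraseLoop hl).1, (h.eraseLoop hl).2⟩
  · rw [if_neg hl]
    exact ⟨hs.arb, hp.right_mem, h, hl⟩

lemma absorb (R : WilsonRule H) (hs : s.Valid H R.root) (hc : s.cur ∈ s.verts) :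
    (s.absorb R).Valid H R.root := by
  have h := hs.arb.union_path hc hs.path
  refine ⟨h, ?_, trivial, by simp [WilsonState.absorb, pathVerts_nil]⟩
  dsimp only [WilsonState.absorb]
  split_ifs with hA
  · exact hs.cur_mem
  · exact (R.next_mem _ _ ((h.subset_vertexSet R.root_mem).ssubset_of_ne hA)).1

lemma path_eq_nil (hs : s.Valid H r) (hA : s.verts = H.vertexSet) : s.path = [] := by
  rcases hp : s.path with _ | ⟨⟨v, e⟩, l⟩
  · rfl
  · have := hs.path
    rw [hp] at this
    exact absurd this.1.left_mem (hA ▸ this.2.1)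

lemma absorb_eq_self (R : WilsonRule H) (hs : s.Valid H r) (hA : s.verts = H.vertexSet) :
    s.absorb R = s := by
  have hp := hs.path_eq_nil hA
  obtain ⟨A, F, l, y⟩ := s
  dsimp only at hp hA
  simp [WilsonState.absorb, hp, hA, pathVerts_nil, pathEdges_nil]

end WilsonState.Valid

/-- A self-avoiding path has at most as many entries as there are vertices. Expectations over the
valid states are therefore finite sums. -/
lemma finite_setOf_valid [Finite α] [Finite β] : {s : WilsonState α β | s.Valid H r}.Finite := by
  have := Fintype.ofFinite α
  have hfin : {t : Set α × Set β × List (α × β) × α | t.2.2.1.length ≤ Fintype.card α}.Finite := by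
    have h1 : {l : List (α × β) | l.length ≤ Fintype.card α}.Finite := List.finite_length_le _ _
    refine ((Set.finite_univ (α := Set α)).prod ((Set.finite_univ (α := Set β)).prod
      (h1.prod (Set.finite_univ (α := α))))).subset ?_
    rintro ⟨A, F, l, y⟩ h
    exact ⟨trivial, trivial, h, trivial⟩
  refine Set.Finite.of_injOn (f := fun s : WilsonState α β => (s.verts, s.edges, s.path, s.cur))
    (fun s hs => ?_) ?_ hfin
  · simpa using hs.path.nodup.length_le_card
  · rintro ⟨A, F, l, y⟩ - ⟨A', F', l', y'⟩ - h
    simpa using h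

end Graph

/-! ### The conditional probability of a given output -/

namespace Graph

universe u v w

variable {α : Type u} {β : Type w} {H : Graph α β} {r : α} {A : Set α}
  {F T : Set β}

lemma lap_add_const_mul [Fintype α] [Fintype β] (φ ψ : α → ℝ) (c : ℝ) (x : α) :
    H.lap (fun y => φ y + c * ψ y) x = H.lap φ x + c * H.lap ψ x := by
  simp only [lap, Finset.mul_sum, ← Finset.sum_add_distrib]
  exact Finset.sum_congr rfl fun _ _ => by ring

namespace Orientation

variable (o : H.Orientation r T)

/-- The path `l` goes along the parent edges. -/
def Follows (l : List (α × β)) : Prop := ∀ a ∈ l, ∃ z, o.par a.1 = some (a.2, z)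

variable {o}

/-- Depth falls along parent edges. It follows that the parent of the current vertex is not on the
path, so a step to it closes no loop. -/
lemma depth_lt_of_follows {l : List (α × β)} {y : α} (h : H.IsPathTo A l y) (hl : o.Follows l)
    {x : α} (hx : x ∈ pathVerts l) : o.depth y < o.depth x := by
  induction l generalizing y with
  | nil => simp [pathVerts] at hx
  | cons a l ih =>
    obtain ⟨v, e⟩ := a
    obtain ⟨z, hz⟩ := hl _ List.mem_cons_self
    have hyv : o.depth y < o.depth v := by
      have := o.depth_lt hz
      rwa [(o.isLink hz).right_unique h.1] at this
    rw [pathVerts_cons] at hx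
    rcases hx with rfl | hx
    · exact hyv
    · exact hyv.trans (ih h.2.2.2 (fun a ha => hl a (List.mem_cons_of_mem _ ha)) hx)

lemma follows_cons {v : α} {e : β} {l : List (α × β)} :
    o.Follows ((v, e) :: l) ↔ (∃ z, o.par v = some (e, z)) ∧ o.Follows l := by
  simp [Follows]

/-- Once the path has reached the tree, its vertices can be attached one by one, and each edge of
`T` that attaches a leaf is the parent edge of that leaf. -/
lemma follows_of_subset {l : List (α × β)} {y : α} (hA : H.IsArb r A F) (hy : y ∈ A)
    (h : H.IsPathTo A l y) (hF : F ⊆ T) (hl : pathEdges l ⊆ T) : o.Follows l := by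
  induction l generalizing y A F with
  | nil => simp [Follows]
  | cons a l ih =>
    obtain ⟨v, e⟩ := a
    rw [pathEdges_cons, Set.insert_subset_iff] at hl
    exact follows_cons.2 ⟨⟨y, o.par_eq_of_isLink hA hF h.2.1 hy h.1 hl.1⟩,
      ih (hA.attach h.2.1 hy h.1) (Or.inl rfl) (h.2.2.2.insert h.2.2.1)
        (Set.insert_subset hl.1 hF) hl.2⟩

lemma pathEdges_subset {l : List (α × β)} (h : o.Follows l) : pathEdges l ⊆ T := by
  intro e he
  obtain ⟨a, ha, rfl⟩ := List.mem_map.1 he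
  obtain ⟨z, hz⟩ := h a ha
  exact o.edge_mem hz

variable [Fintype α] [Fintype β] (o)

open Classical in
/-- The probability that the output is `T`, if the tree has grown to `A ∪ pathVerts l` and
`F ∪ pathEdges l`. -/
noncomputable def weight (A : Set α) (F : Set β) (l : List (α × β)) : ℝ :=
  if F ⊆ T ∧ o.Follows l then ((H.dirichletMatrix (A ∪ pathVerts l)).det)⁻¹ else 0

/-- The contributions to the probability that the output is `T` from the events that the walk,
which is at `y`, returns to a vertex of the path before it hits the tree. -/
noncomputable def returnValue (A : Set α) (F : Set β) : List (α × β) → α → ℝ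
  | [], _ => 0
  | (v, _) :: l, y =>
    returnValue A F l y + o.weight A F l * H.hitProb (A ∪ pathVerts l) v y

/-- The conditional probability, given the state of Wilson's algorithm, that the output is `T`. -/
noncomputable def value (s : WilsonState α β) : ℝ :=
  o.weight s.verts s.edges s.path + o.returnValue s.verts s.edges s.path s.cur

variable {o}

lemma returnValue_of_mem (hH : H.IsConn) {l : List (α × β)} {y z : α} (h : H.IsPathTo A l z)
    (hy : y ∈ A) : o.returnValue A F l y = 0 := by
  induction l generalizing z with
  | nil => rfl
  | cons a l ih =>
    obtain ⟨v, e⟩ := a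
    rw [returnValue, ih h.2.2.2, hitProb_of_mem hH h.1.left_mem (Or.inl hy) fun hyv =>
      h.2.1 (hyv ▸ hy)]
    simp

/-- For path vertices later than `y` the hitting probability is zero, since `y` is on their
boundary; for `y` itself it is one. The terms of the earlier vertices survive, and together this is
the value after the loop at `y` is erased. -/
lemma returnValue_of_mem_path (hH : H.IsConn) {l : List (α × β)} {y z : α}
    (h : H.IsPathTo A l z) (hy : y ∈ pathVerts l) : o.returnValue A F l y =
      o.weight A F (eraseLoop l y) + o.returnValue A F (eraseLoop l y) y := by
  induction l generalizing z with
  | nil => simp [pathVerts] at hy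
  | cons a l ih =>
    obtain ⟨v, e⟩ := a
    rw [returnValue]
    by_cases hvy : v = y
    · subst hvy
      rw [eraseLoop_cons_self, hitProb_self hH h.1.left_mem]
      ring
    · rw [pathVerts_cons] at hy
      have hy := hy.resolve_left (Ne.symm hvy)
      rw [eraseLoop_cons_of_ne l e hvy, ih h.2.2.2 hy,
        hitProb_of_mem hH h.1.left_mem (Or.inr hy) (Ne.symm hvy)]
      ring

lemma lap_returnValue (hH : H.IsConn) {l : List (α × β)} {y z : α} (h : H.IsPathTo A l z)
    (hyV : y ∈ H.vertexSet) (hyA : y ∉ A) (hy : y ∉ pathVerts l) :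
    H.lap (o.returnValue A F l) y = 0 := by
  induction l generalizing z with
  | nil => simp [returnValue, lap]
  | cons a l ih =>
    obtain ⟨v, e⟩ := a
    rw [pathVerts_cons, Set.mem_insert_iff, not_or] at hy
    have := lap_add_const_mul (H := H) (o.returnValue A F l) (H.hitProb (A ∪ pathVerts l) v)
      (o.weight A F l) y
    rw [ih h.2.2.2 hy.2, lap_hitProb hH h.1.left_mem hyV (by simp [hyA, hy.2]) hy.1, mul_zero,
      add_zero] at this
    exact this

-- Whether or not the step closes a loop, the first two terms are the return value of the lengthened
-- path. Only a step that closes no loop adds the weight of that path.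
open Classical in
lemma value_move (hH : H.IsConn) {s : WilsonState α β} (hs : s.Valid H r) (hc : s.cur ∉ s.verts)
    {p : β × α} (hp : H.IsLink p.1 s.cur p.2) : o.value (s.move p) =
      (o.returnValue s.verts s.edges s.path p.2 + o.weight s.verts s.edges s.path *
        H.hitProb (s.verts ∪ pathVerts s.path) s.cur p.2) +
      if p.2 ∈ pathVerts ((s.cur, p.1) :: s.path) then 0
      else o.weight s.verts s.edges ((s.cur, p.1) :: s.path) := by
  have h := hs.path_cons hc hp
  change _ = o.returnValue s.verts s.edges ((s.cur, p.1) :: s.path) p.2 + _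
  rw [move_eq, value]
  dsimp only
  split_ifs with hl
  · rw [returnValue_of_mem_path hH h hl, add_zero]
  · exact add_comm _ _

lemma weight_cons_of_not {v : α} {e : β} {l : List (α × β)} (h : ¬ (F ⊆ T ∧ o.Follows l)) :
    o.weight A F ((v, e) :: l) = 0 :=
  if_neg fun h' => h ⟨h'.1, (follows_cons.1 h'.2).2⟩

open Classical in
/-- The value function is harmonic for the steps of the random walk. -/
lemma sum_value_move (hH : H.IsConn) (hr : r ∈ H.vertexSet)
    (ho : ∀ x ∈ H.vertexSet, x ≠ r → ∃ e y, o.par x = some (e, y))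
    {s : WilsonState α β} (hs : s.Valid H r) (hc : s.cur ∉ s.verts) :
    ∑ p ∈ H.walkSteps s.cur, o.value (s.move p) = (H.walkSteps s.cur).card * o.value s := by
  obtain ⟨A, F, l, y⟩ := s
  have hyl := hs.cur_notMem
  have hyV := hs.cur_mem
  have hpath := hs.path
  have harb := hs.arb
  rw [Finset.sum_congr rfl fun p hp => value_move hH hs hc (mem_walkSteps.1 hp)]
  dsimp only at hc hyl hyV hpath harb ⊢
  rw [Finset.sum_add_distrib]
  have h1 := lap_eq (H := H) (fun x => o.returnValue A F l x + o.weight A F l *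
    H.hitProb (A ∪ pathVerts l) y x) y
  rw [lap_add_const_mul, lap_returnValue hH hpath hyV hc hyl, zero_add, hitProb_self hH hyV] at h1
  have h2 : o.value ⟨A, F, l, y⟩ = o.returnValue A F l y + o.weight A F l * 1 := by
    rw [value]; ring
  rw [h2]
  -- The return terms are harmonic at `y`, except for the one of `y` itself, whose Laplacian is
  -- degree times escape probability. The steps that close no loop must supply exactly this defect.
  suffices (∑ p ∈ H.walkSteps y, if p.2 ∈ pathVerts ((y, p.1) :: l) then 0
      else o.weight A F ((y, p.1) :: l)) =
      o.weight A F l * H.lap (H.hitProb (A ∪ pathVerts l) y) y by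
    rw [this]
    linarith
  by_cases hF : F ⊆ T ∧ o.Follows l
  · have hyr : y ≠ r := fun h => hc (h ▸ harb.root_mem)
    obtain ⟨e₀, z₀, h0⟩ := ho y hyV hyr
    have hyB : y ∉ A ∪ pathVerts l := by simp [hc, hyl]
    have hcr := lap_hitProb_self_mul_det hH hyV hyB
    have hdet : (H.dirichletMatrix (insert y (A ∪ pathVerts l))).det ≠ 0 :=
      det_dirichletMatrix_ne_zero hH ⟨y, Or.inl rfl, hyV⟩
    have hdet' : (H.dirichletMatrix (A ∪ pathVerts l)).det ≠ 0 :=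
      det_dirichletMatrix_ne_zero hH
        ⟨r, Or.inl harb.root_mem, hr⟩
    -- Only the step along the parent edge of `y` keeps the path inside `T`.
    rw [Finset.sum_eq_single (e₀, z₀)]
    · rw [if_neg, weight, weight, if_pos hF, if_pos ⟨hF.1, follows_cons.2 ⟨⟨z₀, h0⟩, hF.2⟩⟩,
        union_pathVerts_cons]
      · field_simp
        linarith
      -- The parent of `y` is shallower than `y`, and `y` is shallower than the path.
      · rw [pathVerts_cons]
        rintro (h | h)
        · exact (o.depth_lt h0).ne (congrArg o.depth h)
        · exact (o.depth_lt h0).not_gt (depth_lt_of_follows hpath hF.2 h)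
    · rintro ⟨e, z⟩ hp hne
      split_ifs with hz
      · rfl
      · refine if_neg fun h => hne ?_
        obtain ⟨z', hz'⟩ := (follows_cons.1 h.2).1
        rw [h0] at hz'
        obtain ⟨rfl, rfl⟩ : e₀ = e ∧ z₀ = z' := by simpa using hz'
        rw [(o.isLink h0).right_unique (mem_walkSteps.1 hp)]
    · exact fun h => absurd (mem_walkSteps.2 (o.isLink h0)) h
  · rw [Finset.sum_eq_zero, weight, if_neg hF, zero_mul]
    intro p _
    rw [weight_cons_of_not hF, ite_self]

-- On the tree all return terms vanish, and the path follows the parents exactly when its edges lie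
-- in `T`. The boundary of the determinant already includes the path.
open Classical in
lemma value_absorb (hH : H.IsConn) {R : WilsonRule H} {o : H.Orientation R.root T}
    {s : WilsonState α β} (hs : s.Valid H R.root) (hc : s.cur ∈ s.verts) :
    o.value (s.absorb R) = o.value s := by
  have h : (s.edges ∪ pathEdges s.path ⊆ T ∧ o.Follows []) ↔ (s.edges ⊆ T ∧ o.Follows s.path) := by
    rw [Set.union_subset_iff]
    exact ⟨fun h => ⟨h.1.1, follows_of_subset hs.arb hc hs.path h.1.1 h.1.2⟩,
      fun h => ⟨⟨h.1, pathEdges_subset h.2⟩, by simp [Follows]⟩⟩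
  rw [value, value, returnValue_of_mem hH hs.path hc, add_zero]
  simp only [WilsonState.absorb, returnValue, weight, pathVerts_nil, Set.union_empty, add_zero]
  exact if_congr h rfl rfl

-- The boundary is now everything, so the determinant is one, and a spanning tree contained in `T`
-- is equal to `T`.
open Classical in
lemma value_of_halted {s : WilsonState α β} (hs : s.Valid H r) (hA : s.verts = H.vertexSet) :
    o.value s = if s.edges = T then 1 else 0 := by
  have h : s.edges ⊆ T ↔ s.edges = T := by
    refine ⟨fun h => h.antisymm fun e he => ?_, fun h => h.le⟩
    obtain ⟨x, y, hx⟩ := o.exists_of_edge e he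
    exact (o.closed hs.arb h (hA ▸ (o.isLink hx).left_mem) hx).1
  have hf : o.Follows [] := by simp [Follows]
  rw [value, hs.path_eq_nil hA, returnValue, add_zero, weight, pathVerts_nil, Set.union_empty, hA,
    det_dirichletMatrix_of_subset subset_rfl, inv_one]
  simp only [h, hf, and_true]

end Orientation

end Graph

/-! ### Wilson's theorem -/

namespace Graph

universe u v w

variable {α : Type u} {β : Type w} [Fintype α] [Fintype β] {H : Graph α β} {r : α}

lemma IsConn.walkSteps_nonempty (hH : H.IsConn) {x y : α} (hx : x ∈ H.vertexSet)
    (hy : y ∈ H.vertexSet) (hxy : x ≠ y) : (H.walkSteps x).Nonempty := by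
  rcases (hH.2 x hx y hy).cases_head with h | ⟨z, ⟨e, he⟩, -⟩
  · exact absurd h hxy
  · exact ⟨(e, z), mem_walkSteps.2 he⟩

open Classical in
/-- A bound, if `K` is large, for the expected number of steps until Wilson's algorithm halts. -/
noncomputable def timeBound (H : Graph α β) (K : ℝ) (s : WilsonState α β) : ℝ :=
  if s.cur ∈ s.verts then
    if s.verts = H.vertexSet then 0
    else K * (H.vertexSet \ (s.verts ∪ pathVerts s.path)).ncard + K
  else K * (H.vertexSet \ s.verts).ncard + H.hitTime s.verts s.cur

lemma exists_hitTime_bound (H : Graph α β) : ∃ K : ℝ, 1 ≤ K ∧ ∀ A x, H.hitTime A x + 1 ≤ K := by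
  obtain ⟨K, hK⟩ := (Set.finite_range fun p : Set α × α => H.hitTime p.1 p.2).bddAbove
  refine ⟨max (K + 1) 1, le_max_right _ _, fun A x => le_max_of_le_left ?_⟩
  have := hK ⟨(A, x), rfl⟩
  dsimp only at this
  linarith

/-- The spare `K` kept while the walk stands on the tree pays for this step and for the expected
hitting time of the next walk, if there is one. -/
lemma timeBound_absorb {K : ℝ} (hK1 : 1 ≤ K) (hK : ∀ A x, H.hitTime A x + 1 ≤ K)
    {R : WilsonRule H} {s : WilsonState α β} (hs : s.Valid H R.root) (hc : s.cur ∈ s.verts)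
    (hA : s.verts ≠ H.vertexSet) : H.timeBound K (s.absorb R) ≤ H.timeBound K s - 1 := by
  have h := hs.arb.union_path hc hs.path
  have hsub := h.subset_vertexSet R.root_mem
  rw [timeBound, timeBound, if_pos hc, if_neg hA]
  by_cases hA' : s.verts ∪ pathVerts s.path = H.vertexSet
  · have h1 : (s.absorb R).cur ∈ (s.absorb R).verts := by
      simp [WilsonState.absorb, hA', hs.cur_mem]
    have h2 : (s.absorb R).verts = H.vertexSet := hA'
    rw [if_pos h1, if_pos h2]
    have : (0 : ℝ) ≤ K * (H.vertexSet \ (s.verts ∪ pathVerts s.path)).ncard := by positivity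
    linarith
  · have h1 : (s.absorb R).cur ∉ (s.absorb R).verts := by
      simp only [WilsonState.absorb, if_neg hA']
      exact (R.next_mem _ _ (hsub.ssubset_of_ne hA')).2
    rw [if_neg h1]
    have := hK (s.absorb R).verts (s.absorb R).cur
    have h2 : (s.absorb R).verts = s.verts ∪ pathVerts s.path := rfl
    rw [h2] at this ⊢
    linarith

/-- When the walk meets the tree, the path contains at least the vertex just left. The number of
uncovered vertices thus drops by one or more, which releases the spare `K`. -/
lemma timeBound_move_le (hH : H.IsConn) {K : ℝ} (hK1 : 1 ≤ K) {s : WilsonState α β}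
    (hr : r ∈ H.vertexSet) (hs : s.Valid H r) (hc : s.cur ∉ s.verts) {p : β × α}
    (hl : H.IsLink p.1 s.cur p.2) :
    H.timeBound K (s.move p) ≤ K * (H.vertexSet \ s.verts).ncard + H.hitTime s.verts p.2 := by
  classical
  rw [timeBound]
  change (if p.2 ∈ s.verts then if s.verts = H.vertexSet then 0 else
    K * (H.vertexSet \ (s.verts ∪ pathVerts (s.move p).path)).ncard + K
    else K * (H.vertexSet \ s.verts).ncard + H.hitTime s.verts p.2) ≤ _
  by_cases hp : p.2 ∈ s.verts
  · have hne : s.verts ≠ H.vertexSet := fun h => hc (h ▸ hs.cur_mem)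
    have hpath : (s.move p).path = (s.cur, p.1) :: s.path := by
      rw [move_eq]
      exact if_neg fun h => ((hs.path_cons hc hl).mem_diff h).2 hp
    rw [if_pos hp, if_neg hne, hitTime_of_mem hH ⟨r, hs.arb.root_mem, hr⟩ hp, hpath,
      union_pathVerts_cons, add_zero]
    have hlt : (H.vertexSet \ insert s.cur (s.verts ∪ pathVerts s.path)).ncard + 1 ≤
        (H.vertexSet \ s.verts).ncard := by
      refine Set.ncard_lt_ncard ⟨?_, fun h => ?_⟩ (Set.toFinite _)
      · exact Set.sdiff_subset_sdiff_right (Set.subset_union_left.trans (Set.subset_insert _ _))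
      · exact (h ⟨hs.cur_mem, hc⟩).2 (Or.inl rfl)
    have : ((H.vertexSet \ insert s.cur (s.verts ∪ pathVerts s.path)).ncard : ℝ) + 1 ≤
        (H.vertexSet \ s.verts).ncard := by exact_mod_cast hlt
    nlinarith
  · rw [if_neg hp]

variable {R : WilsonRule H}

lemma Orientation.expOn_value (hH : H.IsConn) {T : Set β} {o : H.Orientation R.root T}
    (ho : ∀ x ∈ H.vertexSet, x ≠ R.root → ∃ e y, o.par x = some (e, y))
    {X : Finset (WilsonState α β)} (hX : ∀ s, s ∈ X ↔ s.Valid H R.root) {s : WilsonState α β}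
    (hs : s.Valid H R.root) : PMF.expOn X (wilsonStep H R s) o.value = o.value s := by
  by_cases hc : s.cur ∈ s.verts
  · rw [wilsonStep_of_mem hc, PMF.expOn_pure ((hX _).2 (hs.absorb R hc)), value_absorb hH hs hc]
  · have hne := hH.walkSteps_nonempty hs.cur_mem R.root_mem fun h => hc (h ▸ hs.arb.root_mem)
    rw [wilsonStep_of_notMem hc hne, PMF.expOn_map_uniformOfFinset hne _ fun p hp =>
      (hX _).2 (hs.move hc (mem_walkSteps.1 hp)), sum_value_move hH R.root_mem ho hs hc]
    have : ((H.walkSteps s.cur).card : ℝ) ≠ 0 := by exact_mod_cast hne.card_pos.ne'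
    field_simp

lemma expOn_timeBound_le (hH : H.IsConn) {K : ℝ} (hK1 : 1 ≤ K)
    (hK : ∀ A x, H.hitTime A x + 1 ≤ K) {X : Finset (WilsonState α β)}
    (hX : ∀ s, s ∈ X ↔ s.Valid H R.root) {s : WilsonState α β} (hs : s.Valid H R.root)
    (hA : s.verts ≠ H.vertexSet) :
    PMF.expOn X (wilsonStep H R s) (H.timeBound K) ≤ H.timeBound K s - 1 := by
  by_cases hc : s.cur ∈ s.verts
  · rw [wilsonStep_of_mem hc, PMF.expOn_pure ((hX _).2 (hs.absorb R hc))]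
    exact timeBound_absorb hK1 hK hs hc hA
  · have hne := hH.walkSteps_nonempty hs.cur_mem R.root_mem fun h => hc (h ▸ hs.arb.root_mem)
    have hpos : (0 : ℝ) < (H.walkSteps s.cur).card := by exact_mod_cast hne.card_pos
    have hlap := lap_hitTime hH ⟨R.root, hs.arb.root_mem, R.root_mem⟩ ⟨hs.cur_mem, hc⟩
    have hsum := Finset.sum_le_sum fun p hp =>
      timeBound_move_le hH hK1 R.root_mem hs hc (mem_walkSteps.1 hp)
    rw [lap_eq] at hlap
    rw [Finset.sum_add_distrib, Finset.sum_const, nsmul_eq_mul] at hsum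
    rw [wilsonStep_of_notMem hc hne, PMF.expOn_map_uniformOfFinset hne _ fun p hp =>
      (hX _).2 (hs.move hc (mem_walkSteps.1 hp)), inv_mul_le_iff₀ hpos, timeBound, if_neg hc]
    linarith

lemma wilsonStep_support {s s' : WilsonState α β} (hH : H.IsConn) (hs : s.Valid H R.root)
    (hs' : s' ∈ (wilsonStep H R s).support) : s'.Valid H R.root := by
  by_cases hc : s.cur ∈ s.verts
  · rw [wilsonStep_of_mem hc, PMF.support_pure, Set.mem_singleton_iff] at hs'
    exact hs' ▸ hs.absorb R hc
  · have hne := hH.walkSteps_nonempty hs.cur_mem R.root_mem fun h => hc (h ▸ hs.arb.root_mem)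
    rw [wilsonStep_of_notMem hc hne, PMF.mem_support_map_iff] at hs'
    obtain ⟨p, hp, rfl⟩ := hs'
    rw [PMF.support_uniformOfFinset] at hp
    exact hs.move hc (mem_walkSteps.1 hp)

/-- If `f` is harmonic for the steps of Wilson's algorithm and is the indicator function of `D` at
the states where the algorithm has halted, then it gives the probability of halting in `D`. -/
lemma iSup_wilsonRun_eq (hH : H.IsConn) (R : WilsonRule H) {X : Finset (WilsonState α β)}
    (hX : ∀ s, s ∈ X ↔ s.Valid H R.root) {D : Set (WilsonState α β)}
    (hD : ∀ s ∈ D, s.verts = H.vertexSet) {f : WilsonState α β → ℝ}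
    (hf : ∀ s, s.Valid H R.root → PMF.expOn X (wilsonStep H R s) f = f s)
    (hfD : ∀ s, s.Valid H R.root → s.verts = H.vertexSet → f s = D.indicator 1 s) :
    0 ≤ f ⟨{R.root}, ∅, [], R.root⟩ ∧ ⨆ k, (wilsonRun H R k).toOuterMeasure D =
      ENNReal.ofReal (f ⟨{R.root}, ∅, [], R.root⟩) := by
  obtain ⟨K, hK1, hK⟩ := H.exists_hitTime_bound
  refine PMF.iSup_toOuterMeasure_eq (X := X) (step := wilsonStep H R) (run := wilsonRun H R)
    (N := {s | s.verts = H.vertexSet}) (τ := H.timeBound K) rfl (fun _ => rfl) ?_ ?_ hD ?_ ?_ ?_ ?_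
  · exact (hX _).2 ⟨.root, R.root_mem, trivial, by simp [pathVerts_nil]⟩
  · exact fun s hs s' hs' => (hX _).2 (wilsonStep_support hH ((hX s).1 hs) hs')
  · intro s hs hA
    have hs := (hX s).1 hs
    have hc : s.cur ∈ s.verts := by
      have : s.verts = H.vertexSet := hA
      exact this ▸ hs.cur_mem
    rw [wilsonStep_of_mem hc, hs.absorb_eq_self R hA]
  · exact fun s hs => hf s ((hX s).1 hs)
  · exact fun s hs => hfD s ((hX s).1 hs)
  · exact fun s hs hA => expOn_timeBound_le hH hK1 hK hX ((hX s).1 hs) hA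

open Classical in
/-- Wilson's algorithm halts almost surely, and its output is a uniformly random spanning tree. -/
theorem iSup_wilsonRun_halted (hH : H.IsConn) (R : WilsonRule H) (T : Set β) :
    ⨆ k, (wilsonRun H R k).toOuterMeasure {s | s.verts = H.vertexSet ∧ s.edges = T} =
      if T ∈ H.treeSets then (H.treeSets.ncard : ℝ≥0∞)⁻¹ else 0 := by
  set X := (finite_setOf_valid (H := H) (r := R.root)).toFinset
  have hX : ∀ s, s ∈ X ↔ s.Valid H R.root := fun s => by simp [X]
  -- The value at the starting state, the same for every spanning tree.
  set c : ℝ := ((H.dirichletMatrix {R.root}).det)⁻¹ with hc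
  have hval : ∀ T ∈ H.treeSets, ∃ f : WilsonState α β → ℝ,
      (∀ s, s.Valid H R.root → PMF.expOn X (wilsonStep H R s) f = f s) ∧
      (∀ s, s.Valid H R.root → s.verts = H.vertexSet → f s = if s.edges = T then 1 else 0) ∧
      f ⟨{R.root}, ∅, [], R.root⟩ = c := by
    intro T hT
    obtain ⟨o, ho⟩ := ((mem_treeSets_iff R.root_mem).1 hT).exists_orientation
    refine ⟨o.value, fun s hs => o.expOn_value hH ho hX hs,
      fun s hs hA => o.value_of_halted hs hA, ?_⟩
    simp [Orientation.value, Orientation.weight, Orientation.returnValue, Orientation.Follows,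
      pathVerts_nil, hc]
  choose! f hf hfA hf0 using hval
  have htree : ∀ {s : WilsonState α β}, s.Valid H R.root → s.verts = H.vertexSet →
      s.edges ∈ H.treeSets := fun hs hA => (mem_treeSets_iff R.root_mem).2 (hA ▸ hs.arb)
  have hprob : ∀ T ∈ H.treeSets, 0 ≤ c ∧
      ⨆ k, (wilsonRun H R k).toOuterMeasure {s | s.verts = H.vertexSet ∧ s.edges = T} =
        ENNReal.ofReal c := by
    intro T hT
    rw [← hf0 T hT]
    refine iSup_wilsonRun_eq hH R hX (fun s hs => hs.1) (hf T hT) fun s hs hA => ?_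
    rw [hfA T hT s hs hA]
    simp [Set.indicator_apply, hA]
  split_ifs with hT
  · have hc0 := (hprob T hT).1
    -- The constant function one shows that the algorithm halts almost surely.
    have h1 := iSup_wilsonRun_eq hH R hX (D := {s | s.verts = H.vertexSet}) (fun s hs => hs)
      (f := fun _ => 1)
      (fun s hs => PMF.expOn_one fun s' hs' => (hX _).2 (wilsonStep_support hH hs hs'))
      fun s hs hA => by simp [hA]
    -- The sum of the values over all spanning trees has the same boundary values as the constant
    -- one, so the number of trees times `c` is one.
    have h2 := iSup_wilsonRun_eq hH R hX (D := {s | s.verts = H.vertexSet}) (fun s hs => hs)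
      (f := fun s => ∑ T ∈ H.treeSets.toFinset, f T s) (fun s hs => by
        rw [PMF.expOn_sum]
        exact Finset.sum_congr rfl fun T hT => hf T (by simpa using hT) s hs) fun s hs hA => by
        rw [Finset.sum_congr rfl fun T hT => hfA T (by simpa using hT) s hs hA]
        simp [hA, htree hs hA]
    rw [h1.2, Finset.sum_congr rfl fun T hT => hf0 T (by simpa using hT), Finset.sum_const,
      nsmul_eq_mul, ← Set.ncard_eq_toFinset_card'] at h2
    rw [(hprob T hT).2]
    have h3 := h2.2.symm
    rw [ENNReal.ofReal_one, ENNReal.ofReal_mul (by positivity), ENNReal.ofReal_natCast] at h3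
    exact ENNReal.eq_inv_of_mul_eq_one_left (by rwa [mul_comm])
  · have h0 := iSup_wilsonRun_eq hH R hX (D := {s | s.verts = H.vertexSet ∧ s.edges = T})
      (fun s hs => hs.1) (f := fun _ => 0) (fun s _ => by simp [PMF.expOn]) fun s hs hA => by
        have : s.edges ≠ T := fun h => hT (h ▸ htree hs hA)
        simp [this]
    simpa using h0.2

open Classical in
lemma wilsonLaw_singleton (hH : H.IsConn) (R : WilsonRule H) (T : Set β) :
    wilsonLaw H R {T} = if T ∈ H.treeSets then (H.treeSets.ncard : ℝ≥0∞)⁻¹ else 0 := by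
  rw [wilsonLaw, MeasureTheory.Measure.sum_apply _ (MeasurableSet.singleton T),
    tsum_eq_single T, iSup_wilsonRun_halted hH R T]
  · split_ifs <;> simp
  · intro T' hT'
    simp [hT']

lemma isProbabilityMeasure_wilsonLaw (hH : H.IsConn) (R : WilsonRule H) :
    MeasureTheory.IsProbabilityMeasure (wilsonLaw H R) := by
  classical
  refine ⟨?_⟩
  have hne : H.treeSets.ncard ≠ 0 := (Set.ncard_pos (Set.toFinite _)).2 hH.treeSets_nonempty |>.ne'
  rw [← Finset.coe_univ, ← MeasureTheory.sum_measure_singleton]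
  simp only [wilsonLaw_singleton hH]
  rw [← Finset.sum_filter, Finset.sum_const, nsmul_eq_mul, Set.ncard_eq_toFinset_card',
    show Finset.univ.filter (· ∈ H.treeSets) = H.treeSets.toFinset by ext; simp]
  rw [Set.ncard_eq_toFinset_card'] at hne
  exact ENNReal.mul_inv_cancel (by exact_mod_cast hne) (ENNReal.natCast_ne_top _)

end Graph

/-! ### Spanning trees of a multigraph, of its quotient and of its blocks -/

namespace Graph

universe u v w

variable {α : Type u} {α' : Type v} {β : Type w} {H K : Graph α β} {r : α} {A : Set α}
  {F T : Set β} {q : α → α'}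

lemma coarsen_isLink {e : β} {x y : α'} : (H.coarsen q).IsLink e x y ↔
    ∃ u v, H.IsLink e u v ∧ q u = x ∧ q v = y ∧ x ≠ y := by
  have h : (H.coarsen q).IsLink e x y ↔
      (H.map q).IsLink e x y ∧ ¬ ∃ z, (H.map q).IsLoopAt e z := by
    simp [coarsen]
  rw [h, map_isLink]
  constructor
  · rintro ⟨⟨u, v, hl, rfl, rfl⟩, hz⟩
    exact ⟨u, v, hl, rfl, rfl, fun hq => hz ⟨q u, by simpa [← hq] using hl.map q⟩⟩
  · rintro ⟨u, v, hl, rfl, rfl, hne⟩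
    refine ⟨⟨u, v, hl, rfl, rfl⟩, fun ⟨z, hz⟩ => hne ?_⟩
    have h1 := hl.map q
    exact (hz.eq_of_inc h1.inc_left).symm.trans (hz.eq_of_inc h1.inc_right)

lemma vertexSet_coarsen : (H.coarsen q).vertexSet = q '' H.vertexSet := by
  simp [coarsen]

lemma mem_edgeSet_coarsen {e : β} :
    e ∈ (H.coarsen q).edgeSet ↔ ∃ u v, H.IsLink e u v ∧ q u ≠ q v := by
  simp only [edge_mem_iff_exists_isLink, coarsen_isLink]
  constructor
  · rintro ⟨x, y, u, v, h, rfl, rfl, hne⟩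
    exact ⟨u, v, h, hne⟩
  · rintro ⟨u, v, h, hne⟩
    exact ⟨_, _, u, v, h, rfl, rfl, hne⟩

lemma mem_edgeSet_induce {e : β} {S : Set α} :
    e ∈ (H.induce S).edgeSet ↔ ∃ u v, H.IsLink e u v ∧ u ∈ S ∧ v ∈ S := by
  simp [edge_mem_iff_exists_isLink]

lemma edgeSet_coarsen_subset : (H.coarsen q).edgeSet ⊆ H.edgeSet := fun _ he =>
  let ⟨_, _, hl, _⟩ := mem_edgeSet_coarsen.1 he
  hl.edge_mem

lemma edgeSet_induce_subset {S : Set α} : (H.induce S).edgeSet ⊆ H.edgeSet := fun _ he =>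
  let ⟨_, _, hl, _⟩ := mem_edgeSet_induce.1 he
  hl.edge_mem

lemma disjoint_coarsen_induce (v : α') :
    Disjoint (H.coarsen q).edgeSet (H.induce (q ⁻¹' {v})).edgeSet := by
  refine Set.disjoint_left.2 fun e he he' => ?_
  obtain ⟨x, y, hl, hx, hy⟩ := mem_edgeSet_induce.1 he'
  obtain ⟨x', y', hl', hne⟩ := mem_edgeSet_coarsen.1 he
  have hx : q x = v := hx
  have hy : q y = v := hy
  rcases hl'.eq_and_eq_or_eq_and_eq hl with ⟨rfl, rfl⟩ | ⟨rfl, rfl⟩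
  exacts [hne (hx.trans hy.symm), hne (hy.trans hx.symm)]

lemma coarsen_restrict : (H.restrict T).coarsen q = (H.coarsen q).restrict T := by
  refine Graph.ext (by simp [vertexSet_coarsen]) fun e x y => ?_
  simp only [coarsen_isLink, restrict_isLink]
  tauto

lemma inter_mem_treeSets_iff : T ∩ K.edgeSet ∈ K.treeSets ↔ (K.restrict T).IsTree := by
  simp [treeSets]

lemma ncard_of_mem_treeSets [Finite α] [Finite β] (h : T ∈ H.treeSets) :
    T.ncard + 1 = H.vertexSet.ncard := by
  obtain ⟨r, hr⟩ : H.vertexSet.Nonempty := h.2.1.1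
  exact ((mem_treeSets_iff hr).1 h).ncard

/-- A spanning tree grown inside `T` has as many edges as `T`, hence equals it. -/
lemma mem_treeSets_of_isConn [Finite α] [Finite β]
    (hc : (H.restrict T).IsConn) (hcard : T.ncard + 1 = H.vertexSet.ncard) : T ∈ H.treeSets := by
  obtain ⟨r, hr⟩ : H.vertexSet.Nonempty := hc.1
  obtain ⟨F, hF⟩ := hc.exists_isArb (r := r) hr
  have hFT : F ⊆ T := fun e he => (hF.subset_edgeSet he).2
  have h1 : F.ncard + 1 = H.vertexSet.ncard := hF.ncard
  have h2 : F = T := Set.eq_of_subset_of_ncard_le hFT (by omega) (Set.toFinite _)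
  exact (mem_treeSets_iff hr).2 (h2 ▸ hF.of_restrict)

/-- The part of a tree inside a set of vertices is a tree or has fewer edges than a tree. -/
lemma IsArb.inter_or_lt [Finite α] [Finite β] (h : H.IsArb r A F) (S : Set α)
    (hS : (A ∩ S).Nonempty) :
    (∃ r', (H.induce S).IsArb r' (A ∩ S) (F ∩ (H.induce S).edgeSet)) ∨
      (F ∩ (H.induce S).edgeSet).ncard + 1 < (A ∩ S).ncard := by
  induction h with
  | root =>
    obtain ⟨x, rfl, hx⟩ := hS
    refine Or.inl ⟨x, ?_⟩
    rw [Set.singleton_inter_of_mem hx, Set.empty_inter]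
    exact .root
  | @attach A F e x y h hx hy hl ih =>
    by_cases hxS : x ∈ S
    · rw [Set.insert_inter_of_mem hxS]
      have hxA : x ∉ A ∩ S := fun h => hx h.1
      by_cases hyS : y ∈ S
      · have he : e ∈ (H.induce S).edgeSet := mem_edgeSet_induce.2 ⟨x, y, hl, hxS, hyS⟩
        rw [Set.insert_inter_of_mem he]
        rcases ih ⟨y, hy, hyS⟩ with ⟨r', ih⟩ | ih
        · exact Or.inl ⟨r', ih.attach hxA ⟨hy, hyS⟩ (by simp [hl, hxS, hyS])⟩
        · right
          rw [Set.ncard_insert_of_notMem hxA (Set.toFinite _)]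
          have := Set.ncard_insert_le e (F ∩ (H.induce S).edgeSet)
          omega
      · have he : e ∉ (H.induce S).edgeSet := fun he => by
          obtain ⟨u, v, huv, hu, hv⟩ := mem_edgeSet_induce.1 he
          rcases hl.right_eq_or_eq huv with rfl | rfl
          exacts [hyS hu, hyS hv]
        rw [Set.insert_inter_of_notMem he]
        by_cases hne : (A ∩ S).Nonempty
        -- The leaf brings a vertex of `S` but no edge inside `S`, so even a tree becomes one edge
        -- short.
        · right
          rw [Set.ncard_insert_of_notMem hxA (Set.toFinite _)]
          rcases ih hne with ⟨r', ih⟩ | ih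
          · have := ih.ncard
            omega
          · omega
        · left
          have hF : F ∩ (H.induce S).edgeSet = ∅ := by
            refine Set.eq_empty_of_forall_notMem fun f hf => hne ?_
            obtain ⟨u, v, huv, hu, -⟩ := mem_edgeSet_induce.1 hf.2
            exact ⟨u, h.end_mem hf.1 huv, hu⟩
          rw [Set.not_nonempty_iff_eq_empty.1 hne, hF, insert_empty_eq]
          exact ⟨x, .root⟩
    · have he : e ∉ (H.induce S).edgeSet := fun he => by
        obtain ⟨u, v, huv, hu, hv⟩ := mem_edgeSet_induce.1 he
        rcases hl.left_eq_or_eq huv with rfl | rfl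
        exacts [hxS hu, hxS hv]
      rw [Set.insert_inter_of_notMem hxS] at hS ⊢
      rw [Set.insert_inter_of_notMem he]
      exact ih hS

/-- Every edge of a multigraph is an edge of the quotient or lies in exactly one block. -/
lemma ncard_edges_eq [Fintype α'] [Finite β] (hT : T ⊆ H.edgeSet) :
    T.ncard = (T ∩ (H.coarsen q).edgeSet).ncard +
      ∑ v : α', (T ∩ (H.induce (q ⁻¹' {v})).edgeSet).ncard := by
  have hU : T = (T ∩ (H.coarsen q).edgeSet) ∪
      ⋃ v : α', (T ∩ (H.induce (q ⁻¹' {v})).edgeSet) := by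
    refine Set.Subset.antisymm (fun e he => ?_) ?_
    · obtain ⟨x, y, hl⟩ := exists_isLink_of_mem_edgeSet (hT he)
      by_cases hq : q x = q y
      · exact Or.inr (Set.mem_iUnion.2 ⟨q x, he, mem_edgeSet_induce.2 ⟨x, y, hl, rfl, hq.symm⟩⟩)
      · exact Or.inl ⟨he, mem_edgeSet_coarsen.2 ⟨x, y, hl, hq⟩⟩
    · exact Set.union_subset Set.inter_subset_left (Set.iUnion_subset fun _ =>
        Set.inter_subset_left)
  conv_lhs => rw [hU]
  rw [Set.ncard_union_eq _ (Set.toFinite _) (Set.toFinite _),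
    Set.ncard_iUnion_of_finite (fun _ => Set.toFinite _), finsum_eq_sum_of_fintype]
  · intro v v' hne
    refine Set.disjoint_left.2 fun e he he' => hne ?_
    obtain ⟨x, y, hl, hx, hy⟩ := mem_edgeSet_induce.1 he.2
    obtain ⟨x', y', hl', hx', hy'⟩ := mem_edgeSet_induce.1 he'.2
    rcases hl.left_eq_or_eq hl' with rfl | rfl
    exacts [hx.symm.trans hx', hx.symm.trans hy']
  · exact Set.disjoint_iUnion_right.2 fun v => (disjoint_coarsen_induce v).mono
      Set.inter_subset_right Set.inter_subset_right

/-- If `T` coarsens to a spanning tree of the quotient, then it is a spanning tree if and only if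
it restricts to a spanning tree of every block. -/
lemma inter_mem_treeSets_iff_forall [Fintype α] [Fintype α'] [Finite β]
    (hV : H.vertexSet = Set.univ) (hq : Function.Surjective q)
    (hc : T ∩ (H.coarsen q).edgeSet ∈ (H.coarsen q).treeSets) :
    T ∩ H.edgeSet ∈ H.treeSets ↔ ∀ v, T ∩ (H.induce (q ⁻¹' {v})).edgeSet ∈
      (H.induce (q ⁻¹' {v})).treeSets := by
  classical
  wlog hT : T ⊆ H.edgeSet generalizing T
  · have h1 : T ∩ H.edgeSet ∩ (H.coarsen q).edgeSet = T ∩ (H.coarsen q).edgeSet := by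
      rw [Set.inter_assoc, Set.inter_eq_self_of_subset_right edgeSet_coarsen_subset]
    have h2 : ∀ v, T ∩ H.edgeSet ∩ (H.induce (q ⁻¹' {v})).edgeSet =
        T ∩ (H.induce (q ⁻¹' {v})).edgeSet := fun v => by
      rw [Set.inter_assoc, Set.inter_eq_self_of_subset_right edgeSet_induce_subset]
    have := this (T := T ∩ H.edgeSet) (h1 ▸ hc) Set.inter_subset_right
    simpa only [h2, Set.inter_assoc, Set.inter_self] using this
  rw [Set.inter_eq_self_of_subset_left hT]
  have hVc : (H.coarsen q).vertexSet.ncard = Fintype.card α' := by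
    rw [vertexSet_coarsen, hV, Set.image_univ_of_surjective hq, Set.ncard_univ,
      Nat.card_eq_fintype_card]
  have hVs : H.vertexSet.ncard = ∑ v : α', (q ⁻¹' {v}).ncard := by
    rw [← finsum_eq_sum_of_fintype, ← Set.ncard_iUnion_of_finite (fun _ => Set.toFinite _), hV]
    · congr
      ext x
      simp
    · intro v v' hne
      exact Disjoint.preimage q (by simpa using hne)
  have hcc := ncard_of_mem_treeSets hc
  have hedges := ncard_edges_eq (q := q) hT
  have hsum : ∑ v : α', ((T ∩ (H.induce (q ⁻¹' {v})).edgeSet).ncard + 1) =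
      ∑ v : α', (T ∩ (H.induce (q ⁻¹' {v})).edgeSet).ncard + Fintype.card α' := by
    simp [Finset.sum_add_distrib]
  constructor
  · intro h
    by_contra! hex
    obtain ⟨v₀, hv₀⟩ := hex
    have hcard := ncard_of_mem_treeSets h
    obtain ⟨r, hr⟩ : H.vertexSet.Nonempty := h.2.1.1
    have harb := (mem_treeSets_iff hr).1 h
    have hne : ∀ v, (H.vertexSet ∩ q ⁻¹' {v}).Nonempty := fun v => by
      obtain ⟨x, rfl⟩ := hq v
      exact ⟨x, hV ▸ trivial, rfl⟩
    have hle : ∀ v, (T ∩ (H.induce (q ⁻¹' {v})).edgeSet).ncard + 1 ≤ (q ⁻¹' {v}).ncard := by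
      intro v
      have := harb.inter_or_lt _ (hne v)
      rw [hV, Set.univ_inter] at this
      rcases this with ⟨r', h'⟩ | h'
      · exact h'.ncard.le
      · exact h'.le
    have hlt : (T ∩ (H.induce (q ⁻¹' {v₀})).edgeSet).ncard + 1 < (q ⁻¹' {v₀}).ncard := by
      have := harb.inter_or_lt _ (hne v₀)
      rw [hV, Set.univ_inter] at this
      rcases this with ⟨r', h'⟩ | h'
      · exact absurd ((mem_treeSets_iff (H := H.induce (q ⁻¹' {v₀})) h'.root_mem).2 h') hv₀
      · exact h'
    -- The edge counts of `T` and of its coarsening make the sum of (edges in the block + 1) equal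
    -- to the number of vertices, so no block can fall short.
    have := Finset.sum_lt_sum (fun v _ => hle v) ⟨v₀, Finset.mem_univ _, hlt⟩
    omega
  · intro h
    have hblock : ∀ x y, q x = q y → Relation.ReflTransGen (H.restrict T).Adj x y := by
      intro x y hxy
      refine ((h (q y)).2.1.2 x hxy y rfl).lift id ?_
      rintro a b ⟨e, he⟩
      simp only [restrict_isLink, induce_isLink] at he
      exact ⟨e, by simpa using ⟨he.1.1, he.2.1⟩⟩
    -- A walk in the quotient lifts to `T`, with walks inside blocks joining the ends of successive
    -- edges.
    have hlift : ∀ a b, Relation.ReflTransGen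
        ((H.coarsen q).restrict (T ∩ (H.coarsen q).edgeSet)).Adj a b → ∀ x y, q x = a → q y = b →
        Relation.ReflTransGen (H.restrict T).Adj x y := by
      intro a b hab
      induction hab with
      | refl => exact fun x y hx hy => hblock x y (hx.trans hy.symm)
      | @tail b c _ hbc ih =>
        intro x y hx hy
        obtain ⟨e, he⟩ := hbc
        rw [restrict_isLink, coarsen_isLink] at he
        obtain ⟨he, u, w, hl, hu, hw, -⟩ := he
        exact ((ih x u hx hu).tail ⟨e, by simpa using ⟨he.1, hl⟩⟩).trans
          (hblock w y (hw.trans hy.symm))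
    refine mem_treeSets_of_isConn ⟨?_, fun x _ y _ => ?_⟩ ?_
    · obtain ⟨a, ha⟩ := hc.2.1.1
      obtain ⟨x, rfl⟩ := hq a
      exact ⟨x, by simp [hV]⟩
    · refine hlift _ _ (hc.2.1.2 (q x) ?_ (q y) ?_) x y rfl rfl <;>
        simp [vertexSet_coarsen, hV]
    · have h1 : ∀ v, (T ∩ (H.induce (q ⁻¹' {v})).edgeSet).ncard + 1 = (q ⁻¹' {v}).ncard := fun v =>
        ncard_of_mem_treeSets (h v)
      rw [Finset.sum_congr rfl fun v _ => h1 v] at hsum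
      omega

end Graph

/-! ### Hierarchical trees as products of spanning trees -/

namespace Hierarchy

universe u w

variable (h : Hierarchy.{u}) {β : Type w} {H : Graph (h.Node 0) β} {T : Set β}

lemma vertexSet_quot (hV : H.vertexSet = Set.univ) (n : ℕ) :
    (h.quot H n).vertexSet = Set.univ := by
  induction n with
  | zero => exact hV
  | succ n ih =>
    rw [quot, Graph.vertexSet_coarsen, ih, Set.image_univ_of_surjective (h.up_surjective n)]

lemma quot_restrict (n : ℕ) : h.quot (H.restrict T) n = (h.quot H n).restrict T := by
  induction n with
  | zero => rfl
  | succ n ih => rw [quot, quot, ih, Graph.coarsen_restrict]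

lemma edgeSet_quot_anti : Antitone fun n => (h.quot H n).edgeSet :=
  antitone_nat_of_succ_le fun _ => Graph.edgeSet_coarsen_subset

lemma edgeSet_block_subset (n : ℕ) (v : h.Node (n + 1)) :
    (h.block H n v).edgeSet ⊆ (h.quot H n).edgeSet := Graph.edgeSet_induce_subset

/-- An edge inside a block is dropped at the next level and never reappears. -/
lemma disjoint_quot_block {n m : ℕ} (hnm : n < m) (v : h.Node (n + 1)) :
    Disjoint (h.quot H m).edgeSet (h.block H n v).edgeSet :=
  (Graph.disjoint_coarsen_induce v).mono_left (h.edgeSet_quot_anti hnm)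

lemma disjoint_block {ℓ : ℕ} {b c : (n : Fin ℓ) × h.Node (n + 1)} (hbc : b ≠ c) :
    Disjoint (h.block H b.1 b.2).edgeSet (h.block H c.1 c.2).edgeSet := by
  obtain ⟨n, v⟩ := b
  obtain ⟨m, w⟩ := c
  rcases lt_trichotomy n m with hnm | rfl | hnm
  · exact ((h.disjoint_quot_block hnm v).mono_left (h.edgeSet_block_subset m w)).symm
  · refine Set.disjoint_left.2 fun e he he' => hbc ?_
    obtain ⟨x, y, hl, hx, hy⟩ := Graph.mem_edgeSet_induce.1 he
    obtain ⟨x', y', hl', hx', hy'⟩ := Graph.mem_edgeSet_induce.1 he'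
    have : v = w := by
      rcases hl.left_eq_or_eq hl' with rfl | rfl
      exacts [hx.symm.trans hx', hx.symm.trans hy']
    rw [this]
  · exact (h.disjoint_quot_block hnm w).mono_left (h.edgeSet_block_subset n v)

lemma exists_mem_edgeSet (ℓ : ℕ) {e : β} (he : e ∈ H.edgeSet) : e ∈ (h.quot H ℓ).edgeSet ∨
    ∃ b : (n : Fin ℓ) × h.Node (n + 1), e ∈ (h.block H b.1 b.2).edgeSet := by
  induction ℓ with
  | zero => exact Or.inl he
  | succ ℓ ih =>
    rcases ih with hq | ⟨⟨n, v⟩, hb⟩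
    · obtain ⟨x, y, hl⟩ := Graph.exists_isLink_of_mem_edgeSet hq
      by_cases hxy : h.up ℓ x = h.up ℓ y
      · exact Or.inr ⟨⟨Fin.last ℓ, h.up ℓ x⟩,
          Graph.mem_edgeSet_induce.2 ⟨x, y, hl, rfl, hxy.symm⟩⟩
      · exact Or.inl (Graph.mem_edgeSet_coarsen.2 ⟨x, y, hl, hxy⟩)
    · exact Or.inr ⟨⟨n.castSucc, v⟩, hb⟩

/-- A set of edges is a hierarchical tree if and only if it consists of spanning trees of the
coarsest quotient and of all blocks. -/
lemma mem_hierTrees_iff [∀ n, Fintype (h.Node n)] [Finite β] (hV : H.vertexSet = Set.univ) (ℓ : ℕ) :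
    T ∈ h.hierTrees ℓ H ↔ T ⊆ H.edgeSet ∧
      T ∩ (h.quot H ℓ).edgeSet ∈ (h.quot H ℓ).treeSets ∧
      ∀ b : (n : Fin ℓ) × h.Node (n + 1),
        T ∩ (h.block H b.1 b.2).edgeSet ∈ (h.block H b.1 b.2).treeSets := by
  have h1 : T ∈ h.hierTrees ℓ H ↔ T ⊆ H.edgeSet ∧
      ∀ n ≤ ℓ, T ∩ (h.quot H n).edgeSet ∈ (h.quot H n).treeSets := by
    simp only [hierTrees, Set.mem_ofPred_eq, quot_restrict, Graph.isSpanningTreeOf_restrict_iff,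
      Graph.inter_mem_treeSets_iff]
  have step : ∀ n, T ∩ (h.quot H (n + 1)).edgeSet ∈ (h.quot H (n + 1)).treeSets →
      (T ∩ (h.quot H n).edgeSet ∈ (h.quot H n).treeSets ↔
        ∀ v, T ∩ (h.block H n v).edgeSet ∈ (h.block H n v).treeSets) := fun n hn =>
    Graph.inter_mem_treeSets_iff_forall (h.vertexSet_quot hV n) (h.up_surjective n) hn
  rw [h1, and_congr_right_iff]
  refine fun _ => ⟨fun ht => ⟨ht ℓ le_rfl, ?_⟩, fun ⟨htop, hb⟩ n hn => ?_⟩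
  · rintro ⟨n, v⟩
    exact (step n (ht _ n.2)).1 (ht _ n.2.le) v
  -- The induction descends from `ℓ`, because `step n` presupposes a tree at level `n + 1`.
  · induction hn using Nat.decreasingInduction with
    | self => exact htop
    | of_succ n hn ih => exact (step n ih).2 fun v => hb ⟨⟨n, hn⟩, v⟩

/-- The union of a tree of the coarsest quotient and of trees of the blocks. -/
def assemble {ι : Type*} (p : Set β × (ι → Set β)) : Set β := p.1 ∪ ⋃ b, p.2 b

section assemble

variable {ℓ : ℕ} {p : Set β × ((n : Fin ℓ) × h.Node (n + 1) → Set β)}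

lemma assemble_inter_quot (h1 : p.1 ⊆ (h.quot H ℓ).edgeSet)
    (h2 : ∀ b, p.2 b ⊆ (h.block H b.1 b.2).edgeSet) :
    assemble p ∩ (h.quot H ℓ).edgeSet = p.1 := by
  refine Set.Subset.antisymm ?_ fun e he => ⟨Or.inl he, h1 he⟩
  rintro e ⟨he | he, he'⟩
  · exact he
  · obtain ⟨b, hb⟩ := Set.mem_iUnion.1 he
    exact absurd (h2 b hb) (Set.disjoint_left.1 (h.disjoint_quot_block b.1.2 b.2) he')

lemma assemble_inter_block (h1 : p.1 ⊆ (h.quot H ℓ).edgeSet)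
    (h2 : ∀ b, p.2 b ⊆ (h.block H b.1 b.2).edgeSet) (b : (n : Fin ℓ) × h.Node (n + 1)) :
    assemble p ∩ (h.block H b.1 b.2).edgeSet = p.2 b := by
  refine Set.Subset.antisymm ?_ fun e he => ⟨Or.inr (Set.mem_iUnion.2 ⟨b, he⟩), h2 b he⟩
  rintro e ⟨he | he, he'⟩
  · exact absurd he' (Set.disjoint_left.1 (h.disjoint_quot_block b.1.2 b.2) (h1 he))
  · obtain ⟨c, hc⟩ := Set.mem_iUnion.1 he
    by_cases hcb : c = b
    · exact hcb ▸ hc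
    · exact absurd he' (Set.disjoint_left.1 (h.disjoint_block hcb) (h2 c hc))

/-- The families of spanning trees of the coarsest quotient and of the blocks. -/
def treeFamilies (ℓ : ℕ) (H : Graph (h.Node 0) β) :
    Set (Set β × ((n : Fin ℓ) × h.Node (n + 1) → Set β)) :=
  {p | p.1 ∈ (h.quot H ℓ).treeSets ∧ ∀ b, p.2 b ∈ (h.block H b.1 b.2).treeSets}

/-- The coarsest quotient and the blocks partition the edges, so intersecting with each piece
recovers the family from its union. -/
lemma bijOn_assemble [∀ n, Fintype (h.Node n)] [Finite β] (hV : H.vertexSet = Set.univ) (ℓ : ℕ) :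
    Set.BijOn assemble (h.treeFamilies ℓ H) (h.hierTrees ℓ H) := by
  refine ⟨fun p hp => ?_, fun p hp p' hp' hpp' => ?_, fun T hT => ?_⟩
  · have h2 := fun b => (hp.2 b).1
    rw [mem_hierTrees_iff h hV, h.assemble_inter_quot hp.1.1 h2]
    refine ⟨Set.union_subset (hp.1.1.trans (h.edgeSet_quot_anti (Nat.zero_le _)))
      (Set.iUnion_subset fun b => (h2 b).trans ((h.edgeSet_block_subset _ _).trans
        (h.edgeSet_quot_anti (Nat.zero_le _)))), hp.1, fun b => ?_⟩
    rw [h.assemble_inter_block hp.1.1 h2]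
    exact hp.2 b
  · have h2 := fun b => (hp.2 b).1
    have h2' := fun b => (hp'.2 b).1
    refine Prod.ext ?_ (funext fun b => ?_)
    · rw [← h.assemble_inter_quot hp.1.1 h2, hpp', h.assemble_inter_quot hp'.1.1 h2']
    · rw [← h.assemble_inter_block hp.1.1 h2, hpp', h.assemble_inter_block hp'.1.1 h2']
  · rw [mem_hierTrees_iff h hV] at hT
    refine ⟨(T ∩ (h.quot H ℓ).edgeSet, fun b => T ∩ (h.block H b.1 b.2).edgeSet), hT.2, ?_⟩
    refine Set.Subset.antisymm (Set.union_subset Set.inter_subset_left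
      (Set.iUnion_subset fun _ => Set.inter_subset_left)) fun e he => ?_
    rcases h.exists_mem_edgeSet ℓ (hT.1 he) with hq | ⟨b, hb⟩
    · exact Or.inl ⟨he, hq⟩
    · exact Or.inr (Set.mem_iUnion.2 ⟨b, he, hb⟩)

end assemble

section law

variable [∀ n, Fintype (h.Node n)] [Fintype β] {ℓ : ℕ}

open Classical in
/-- The assembled tree is a uniformly random hierarchical tree. -/
theorem drawLaw_singleton (hV : H.vertexSet = Set.univ) (htop : (h.quot H ℓ).IsConn)
    (hblock : ∀ b : (n : Fin ℓ) × h.Node (n + 1), (h.block H b.1 b.2).IsConn)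
    (R : (h.quot H ℓ).WilsonRule)
    (S : ∀ b : (n : Fin ℓ) × h.Node (n + 1), (h.block H b.1 b.2).WilsonRule) (T : Set β) :
    h.drawLaw ℓ H R S {T} =
      if T ∈ h.hierTrees ℓ H then ((h.hierTrees ℓ H).ncard : ℝ≥0∞)⁻¹ else 0 := by
  have hR := Graph.isProbabilityMeasure_wilsonLaw htop R
  have hS := fun b => Graph.isProbabilityMeasure_wilsonLaw (hblock b) (S b)
  have hmeas : Measurable (assemble (β := β) (ι := (n : Fin ℓ) × h.Node (n + 1))) :=
    Measurable.of_discrete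
  set μ := (Graph.wilsonLaw _ R).prod (MeasureTheory.Measure.pi fun b => Graph.wilsonLaw _ (S b))
    with hμ
  set c : ℝ≥0∞ := ((h.quot H ℓ).treeSets.ncard : ℝ≥0∞)⁻¹ *
    ∏ b : (n : Fin ℓ) × h.Node (n + 1), ((h.block H b.1 b.2).treeSets.ncard : ℝ≥0∞)⁻¹ with hc
  have hpoint : ∀ p, μ {p} = if p ∈ h.treeFamilies ℓ H then c else 0 := by
    rintro ⟨p, f⟩
    rw [← Set.singleton_prod_singleton, hμ, MeasureTheory.Measure.prod_prod,
      MeasureTheory.Measure.pi_singleton, Graph.wilsonLaw_singleton htop]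
    simp only [fun b => Graph.wilsonLaw_singleton (hblock b)]
    split_ifs with h1 h2 h2
    · rw [Finset.prod_congr rfl fun b _ => if_pos (h2.2 b)]
    · obtain ⟨b, hb⟩ := not_forall.1 fun hf => h2 ⟨h1, hf⟩
      rw [Finset.prod_eq_zero (Finset.mem_univ b) (if_neg hb), mul_zero]
    · exact absurd h2.1 h1
    · rw [zero_mul]
  have hdraw : ∀ T, h.drawLaw ℓ H R S {T} = if T ∈ h.hierTrees ℓ H then c else 0 := by
    intro T
    change μ.map assemble {T} = _
    rw [MeasureTheory.Measure.map_apply hmeas (MeasurableSet.singleton T),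
      ← Set.coe_toFinset (assemble ⁻¹' {T}), ← MeasureTheory.sum_measure_singleton]
    simp only [hpoint]
    have hbij := h.bijOn_assemble hV ℓ
    split_ifs with hT
    · obtain ⟨p, hp, rfl⟩ := hbij.surjOn hT
      rw [Finset.sum_eq_single p, if_pos hp]
      · intro p' hp' hne
        refine if_neg fun hp'' => hne (hbij.injOn hp'' hp ?_)
        simpa using hp'
      · intro hp'
        simp at hp'
    · refine Finset.sum_eq_zero fun p hp => if_neg fun hp' => hT ?_
      have : assemble p = T := by simpa using hp
      exact this ▸ hbij.mapsTo hp'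
  -- All hierarchical trees have the same mass `c`; total mass one then determines `c` without any
  -- count of the families.
  have huniv : h.drawLaw ℓ H R S Set.univ = 1 := by
    change μ.map assemble Set.univ = _
    rw [MeasureTheory.Measure.map_apply hmeas MeasurableSet.univ, Set.preimage_univ]
    exact MeasureTheory.measure_univ
  rw [← Finset.coe_univ, ← MeasureTheory.sum_measure_singleton] at huniv
  simp only [hdraw] at huniv
  rw [← Finset.sum_filter, Finset.sum_const, nsmul_eq_mul,
    show Finset.univ.filter (· ∈ h.hierTrees ℓ H) = (h.hierTrees ℓ H).toFinset by ext; simp,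
    ← Set.ncard_eq_toFinset_card', mul_comm] at huniv
  rw [hdraw, ENNReal.eq_inv_of_mul_eq_one_left huniv]

end law

end Hierarchy

/-! ### The main theorem -/

theorem theorem2 (h : Hierarchy) [∀ n, Fintype (h.Node n)] (ℓ : ℕ)
    (G : SimpleGraph (h.Node 0))
    (htop : (h.quot (Graph.ofSimpleGraph G) ℓ).IsConn)
    (hblock : ∀ (n : Fin ℓ) (v : h.Node (n + 1)), (h.block (Graph.ofSimpleGraph G) n v).IsConn)
    (R : (h.quot (Graph.ofSimpleGraph G) ℓ).WilsonRule)
    (S : ∀ b : (n : Fin ℓ) × h.Node (n + 1),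
      (h.block (Graph.ofSimpleGraph G) b.1 b.2).WilsonRule) :
    -- every run of Wilson's algorithm halts with probability one
    MeasureTheory.IsProbabilityMeasure (Graph.wilsonLaw _ R) ∧
    (∀ b, MeasureTheory.IsProbabilityMeasure (Graph.wilsonLaw _ (S b))) ∧
    -- the assembled tree is a uniformly random hierarchical tree
    (h.hierTrees ℓ (Graph.ofSimpleGraph G)).Nonempty ∧
    h.drawLaw ℓ (Graph.ofSimpleGraph G) R S =
      ProbabilityTheory.uniformOn (h.hierTrees ℓ (Graph.ofSimpleGraph G)) ∧
    ∀ T ∈ h.hierTrees ℓ (Graph.ofSimpleGraph G),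
      h.drawLaw ℓ (Graph.ofSimpleGraph G) R S {T} =
        1 / ((h.hierTrees ℓ (Graph.ofSimpleGraph G)).ncard : ℝ≥0∞) := by
  classical
  have hV : (Graph.ofSimpleGraph G).vertexSet = Set.univ := rfl
  have hb : ∀ b : (n : Fin ℓ) × h.Node (n + 1),
      (h.block (Graph.ofSimpleGraph G) b.1 b.2).IsConn := fun b => hblock b.1 b.2
  have hlaw := h.drawLaw_singleton hV htop hb R S
  refine ⟨Graph.isProbabilityMeasure_wilsonLaw htop R,
    fun b => Graph.isProbabilityMeasure_wilsonLaw (hb b) (S b), ?_, ?_, fun T hT => ?_⟩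
  · obtain ⟨T, hT⟩ := htop.treeSets_nonempty
    choose f hf using fun b => (hb b).treeSets_nonempty
    exact ⟨_, (h.bijOn_assemble hV ℓ).mapsTo (x := (T, f)) ⟨hT, hf⟩⟩
  · refine MeasureTheory.Measure.ext_of_singleton fun T => ?_
    rw [hlaw, ProbabilityTheory.uniformOn,
      ProbabilityTheory.cond_apply (Set.toFinite _).measurableSet,
      MeasureTheory.Measure.count_apply_finite _ (Set.toFinite _),
      ← Set.ncard_eq_toFinset_card _ (Set.toFinite _)]
    split_ifs with hT
    · rw [Set.inter_eq_self_of_subset_right (Set.singleton_subset_iff.2 hT),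
        MeasureTheory.Measure.count_singleton, mul_one]
    · rw [Set.inter_singleton_eq_empty.2 hT, MeasureTheory.measure_empty, mul_zero]
  · rw [hlaw, if_pos hT, one_div]
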